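/- Let $G=(V,E)$ be a finite connected simple graph and $G'=(V,E')$ a simple graph with $E\subseteq E'$; put $F_{GG'}=E'\setminus E$. For distinct nodes $s,t$, an $st$-cut of $G$ is an inclusion-minimal set $C\subseteq E$ such that $s$ and $t$ are not connected in $(V,E\setminus C)$. Let $X_{GG'}$ be the set of all $x\in\{0,1\}^{E'}$ such that $$x_e\le\sum_{e'\in Y\setminus\{e\}}x_{e'}\ \text{ for every cycle } Y \text{ of } G \text{ and every } e\in Y,$$ $$x_{st}\le\sum_{e\in P}x_e\ \text{ for every } st\in F_{GG'} \text{ and every } st\text{-path } P \text{ in } G,$$ $$1-x_{st}\le\sum_{e\in C}(1-x_e)\ \text{ for every } st\in F_{GG'} \text{ and every } st\text{-cut } C \text{ of } G,$$ and let $\Xi_{GG'}=\operatorname{conv}X_{GG'}\subseteq\mathbb{R}^{E'}$ be the lifted multicut polytope. For $vw\in F_{GG'}$ and a $vw$-cut $C$ of $G$ let $$\Sigma_{GG'}(vw,C)=\operatorname{conv}\Big\{x\in X_{GG'}\ \Big|\ 1-x_{vw}=\sum_{e\in C}(1-x_e)\Big\}.$$ Let $V(v,C)$ and $V(w,C)$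 be the node sets of the connected components of $(V,E\setminus C)$ that contain $v$ and $w$, let $F_{GG'}(vw,C)$ be the set of those $f\in F_{GG'}\setminus\{vw\}$ with $f\not\subseteq V(v,C)$ and $f\not\subseteq V(w,C)$, and let $G'(vw,C)=(V,F_{GG'}(vw,C)\cup C)$. A component of $G$ is a nonempty connected induced subgraph $(V^*,E^*)$ of $G$ (not necessarily maximal). It is properly $(vw,C)$-connected if $v,w\in V^*$ and $|E^*\cap C|=1$, improperly $(vw,C)$-connected if $V^*\subseteq V(v,C)$ or $V^*\subseteq V(w,C)$, and $(vw,C)$-connected if it is one or the other. Let $F_{V^*}$ be the set of those edges in $F_{GG'}(vw,C)$ that have both end nodes in $V^*$. **Theorem.** Let $vw\in F_{GG'}$ and let $C=\{\bar e\}$ be a $vw$-cut of $G$ that consists of a single edge. Then $\Sigma_{GG'}(vw,C)$ is a facet of $\Xi_{GG'}$ if and only if all of the following conditions hold: (C1) For every $e\in C$ there is a $(vw,C)$-connected component $(V^*,E^*)$ of $G$ with $e\in E^*$. (C2) For every $\emptyset\ne F\subseteq F_{GG'}(vw,C)$ there are an edge $e\in C$ and $(vw,C)$-connected components $(V^*,E^*)$,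 $(V^{**},E^{**})$ of $G$ with $e\in E^*$, $e\in E^{**}$ and $|F\cap F_{V^*}|\ne|F\cap F_{V^{**}}|$. (C3) For every $f'\in F_{GG'}(vw,C)$, every $\emptyset\ne F\subseteq F_{GG'}(vw,C)\setminus\{f'\}$ and every $k\in\mathbb{N}$ (including $0$) there are $(vw,C)$-connected components $(V^*,E^*)$, $(V^{**},E^{**})$ of $G$ with $f'\in F_{V^*}$ and $f'\notin F_{V^{**}}$ such that $|F\cap F_{V^*}|\ne k$ or $|F\cap F_{V^{**}}|\ne0$. (C4) For every $v'\in V(v,C)$, every $w'\in V(w,C)$ and every $v'w'$-path $P=(V_P,E_P)$ in $G'(vw,C)$ other than the path whose only edge is $\bar e$, there is a properly $(vw,C)$-connected component $(V^*,E^*)$ of $G$ such that ($v'\notin V^*$ or some $w''\in V_P\cap V(w,C)$ is not in $V^*$) and ($w'\notin V^*$ or some $v''\in V_P\cap V(v,C)$ is not in $V^*$). (C5) For every cycle $Y=(V_Y,E_Y)$ in $G'(vw,C)$ there is a properly $(vw,C)$-connected component $(V^*,E^*)$ of $G$ such that some $v'\in V_Y\cap V(v,C)$ is not in $V^*$ and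 some $w'\in V_Y\cap V(w,C)$ is not in $V^*$. -/

import Mathlib

namespace LiftedMulticut

/-- A `v`-`w`-cut of `G`: an inclusion-minimal set `C` of edges of `G` such that `v` and `w` are
not connected in `(V, E \ C)`. -/
def IsCut {V : Type*} (G : SimpleGraph V) (v w : V) (C : Set (Sym2 V)) : Prop :=
  C ⊆ G.edgeSet ∧ ¬ (G.deleteEdges C).Reachable v w ∧
    ∀ D : Set (Sym2 V), D ⊂ C → (G.deleteEdges D).Reachable v w

open Classical in
/-- The set `X_{GG'}` of all `x ∈ {0,1}^{E'}` that satisfy the cycle inequalities (for the cycles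
of `G`) and the path and cut inequalities (for the edges in `E' \ E`). -/
def vertices {V : Type*} [Fintype V] (G G' : SimpleGraph V) : Set (G'.edgeSet → ℝ) :=
  {x | (∀ e, x e = 0 ∨ x e = 1) ∧
    (∀ (u : V) (Y : G.Walk u u), Y.IsCycle → ∀ e : G'.edgeSet, (e : Sym2 V) ∈ Y.edges →
      x e ≤
          ∑ e' ∈ Finset.univ.filter (fun e' : G'.edgeSet => (e' : Sym2 V) ∈ Y.edges ∧ e' ≠ e), x e') ∧
    (∀ (s t : V) (f : G'.edgeSet), (f : Sym2 V) = s(s, t) → (f : Sym2 V) ∉ G.edgeSet →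
      ∀ P : G.Walk s t, P.IsPath →
        x f ≤
          ∑ e ∈ Finset.univ.filter (fun e : G'.edgeSet => (e : Sym2 V) ∈ P.edges), x e) ∧
    (∀ (s t : V) (f : G'.edgeSet), (f : Sym2 V) = s(s, t) → (f : Sym2 V) ∉ G.edgeSet →
      ∀ C : Set (Sym2 V), IsCut G s t C →
        1 - x f ≤
          ∑ e ∈ Finset.univ.filter (fun e : G'.edgeSet => (e : Sym2 V) ∈ C), (1 - x e))}

/-- The lifted multicut polytope `Ξ_{GG'}`. -/
def polytope {V : Type*} [Fintype V] (G G' : SimpleGraph V) : Set (G'.edgeSet → ℝ) :=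
  convexHull ℝ (vertices G G')

open Classical in
/-- The set `S_{GG'}(f, C)` of those `x ∈ X_{GG'}` that satisfy the cut inequality for `f` and `C`
with equality. -/
def cutFaceVertices {V : Type*} [Fintype V] (G G' : SimpleGraph V) (f : G'.edgeSet)
    (C : Set (Sym2 V)) : Set (G'.edgeSet → ℝ) :=
  {x | x ∈ vertices G G' ∧
    1 - x f =
      ∑ e ∈ Finset.univ.filter (fun e : G'.edgeSet => (e : Sym2 V) ∈ C), (1 - x e)}

/-- The polytope `Σ_{GG'}(f, C)`. -/
def cutFace {V : Type*} [Fintype V] (G G' : SimpleGraph V) (f : G'.edgeSet)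
    (C : Set (Sym2 V)) : Set (G'.edgeSet → ℝ) :=
  convexHull ℝ (cutFaceVertices G G' f C)

/-- `Q` is a facet of the polytope `P`: a nonempty (exposed) face of `P` whose dimension is one
less than the dimension of `P`. -/
def IsFacet {ι : Type*} (P Q : Set (ι → ℝ)) : Prop :=
  Q.Nonempty ∧ IsExposed ℝ P Q ∧
    Module.finrank ℝ (vectorSpan ℝ Q) + 1 = Module.finrank ℝ (vectorSpan ℝ P)

/-- The node set `V(v, C)` of the largest component of `(V, E \ C)` that contains `v`. -/
def side {V : Type*} (G : SimpleGraph V) (C : Set (Sym2 V)) (v : V) : Set V :=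
  {u | (G.deleteEdges C).Reachable v u}

/-- The set `F_{GG'}(vw, C)` of those edges in `E' \ E`, except `vw`, that cross the cut `C`. -/
def crossing {V : Type*} (G G' : SimpleGraph V) (v w : V) (C : Set (Sym2 V)) : Set (Sym2 V) :=
  {f | f ∈ G'.edgeSet ∧ f ∉ G.edgeSet ∧ f ≠ s(v, w) ∧
    ¬ (∀ u ∈ f, u ∈ side G C v) ∧ ¬ (∀ u ∈ f, u ∈ side G C w)}

/-- The graph `G'(vw, C) = (V, F_{GG'}(vw, C) ∪ C)`. -/
def crossingGraph {V : Type*} (G G' : SimpleGraph V) (v w : V) (C : Set (Sym2 V)) :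
    SimpleGraph V :=
  SimpleGraph.fromEdgeSet (crossing G G' v w C ∪ C)

/-- The node set `U` induces a component (a nonempty connected induced subgraph, not necessarily
maximal) of `G`. -/
def IsComponent {V : Type*} (G : SimpleGraph V) (U : Set V) : Prop :=
  (G.induce U).Connected

/-- The edges of the subgraph of `G` induced by `U`. -/
def edgesIn {V : Type*} (G : SimpleGraph V) (U : Set V) : Set (Sym2 V) :=
  {e | e ∈ G.edgeSet ∧ ∀ u ∈ e, u ∈ U}

/-- `U` induces a properly `(vw, C)`-connected component of `G`. -/
def ProperlyConnected {V : Type*} (G : SimpleGraph V) (v w : V) (C : Set (Sym2 V))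
    (U : Set V) : Prop :=
  IsComponent G U ∧ v ∈ U ∧ w ∈ U ∧ (edgesIn G U ∩ C).ncard = 1

/-- `U` induces an improperly `(vw, C)`-connected component of `G`. -/
def ImproperlyConnected {V : Type*} (G : SimpleGraph V) (v w : V) (C : Set (Sym2 V))
    (U : Set V) : Prop :=
  IsComponent G U ∧ (U ⊆ side G C v ∨ U ⊆ side G C w)

/-- `U` induces a `(vw, C)`-connected component of `G`. -/
def CutConnected {V : Type*} (G : SimpleGraph V) (v w : V) (C : Set (Sym2 V))
    (U : Set V) : Prop :=
  ProperlyConnected G v w C U ∨ ImproperlyConnected G v w C U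

/-- The set `F_U` of those edges in `F_{GG'}(vw, C)` that have both end nodes in `U`. -/
def crossingIn {V : Type*} (G G' : SimpleGraph V) (v w : V) (C : Set (Sym2 V))
    (U : Set V) : Set (Sym2 V) :=
  {f | f ∈ crossing G G' v w C ∧ ∀ u ∈ f, u ∈ U}

def CutCondition1 {V : Type*} (G : SimpleGraph V) (v w : V) (C : Set (Sym2 V)) : Prop :=
  ∀ e ∈ C, ∃ U : Set V, CutConnected G v w C U ∧ e ∈ edgesIn G U

def CutCondition2 {V : Type*} (G G' : SimpleGraph V) (v w : V) (C : Set (Sym2 V)) : Prop :=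
  ∀ F : Set (Sym2 V), F.Nonempty → F ⊆ crossing G G' v w C →
    ∃ e ∈ C, ∃ U₁ U₂ : Set V, CutConnected G v w C U₁ ∧ CutConnected G v w C U₂ ∧
      e ∈ edgesIn G U₁ ∧ e ∈ edgesIn G U₂ ∧
      (F ∩ crossingIn G G' v w C U₁).ncard ≠ (F ∩ crossingIn G G' v w C U₂).ncard

def CutCondition3 {V : Type*} (G G' : SimpleGraph V) (v w : V) (C : Set (Sym2 V)) : Prop :=
  ∀ f' ∈ crossing G G' v w C, ∀ F : Set (Sym2 V), F.Nonempty →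
    F ⊆ crossing G G' v w C \ {f'} → ∀ k : ℕ,
      ∃ U₁ U₂ : Set V, CutConnected G v w C U₁ ∧ CutConnected G v w C U₂ ∧
        f' ∈ crossingIn G G' v w C U₁ ∧ f' ∉ crossingIn G G' v w C U₂ ∧
        ((F ∩ crossingIn G G' v w C U₁).ncard ≠ k ∨ (F ∩ crossingIn G G' v w C U₂).ncard ≠ 0)

/-- The path that consists of nothing but the only edge of a one-element cut is exempt: both of
its end nodes lie in every properly `(vw, C)`-connected component. -/
def CutCondition4 {V : Type*} (G G' : SimpleGraph V) (v w : V) (C : Set (Sym2 V)) : Prop :=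
  ∀ v' ∈ side G C v, ∀ w' ∈ side G C w, ∀ P : (crossingGraph G G' v w C).Walk v' w', P.IsPath →
    (¬ ∃ e, C = {e} ∧ P.edges = [e]) →
    ∃ U : Set V, ProperlyConnected G v w C U ∧
      (v' ∉ U ∨ ∃ w'' ∈ P.support, w'' ∈ side G C w ∧ w'' ∉ U) ∧
      (w' ∉ U ∨ ∃ v'' ∈ P.support, v'' ∈ side G C v ∧ v'' ∉ U)

def CutCondition5 {V : Type*} (G G' : SimpleGraph V) (v w : V) (C : Set (Sym2 V)) : Prop :=
  ∀ (y : V) (Y : (crossingGraph G G' v w C).Walk y y), Y.IsCycle →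
    ∃ U : Set V, ProperlyConnected G v w C U ∧
      (∃ v' ∈ Y.support, v' ∈ side G C v ∧ v' ∉ U) ∧
      (∃ w' ∈ Y.support, w' ∈ side G C w ∧ w' ∉ U)

end LiftedMulticut

/-!
The cut consists of a bridge `ab` of `G`, with `a` on the side of `v` and `b` on the side of `w`.
A vertex `x` of the face satisfies `x_{vw} = x_{ab}`. If this value is `1`, every edge between the
two sides is cut. If it is `0`, the uncut edges of `G` connect `v` and `w`, and a crossing edge has
the value `0` if and only if both its ends lie in the component `U` of `v`, which is properly
connected (`IsBridgeCut.exists_cutConnected_of_mem_face`). Since the polytope is full-dimensional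
(`vectorSpan_vertices`), the face is a facet if and only if every linear equation that is valid on
it has zero coefficients at all edges but `ab` and `vw` (`IsBridgeCut.isFacet_iff`).

Call the nodes that lie in all properly connected sets the *core*. Both sides of the theorem turn
out to be equivalent to the following property `IsThin` of the crossing edges, other than `vw`, that
are not edges of `G`: none of them joins two core nodes, and no node is joined by two of them to
core nodes.

* If the second or the third condition fails, the violating set of edges is the support of an
  equation valid on the face, so the face is not a facet
  (`IsBridgeCut.cutCondition2_of_isFacet`, `IsBridgeCut.cutCondition3_of_isFacet`).
* The second and the third condition, applied to single edges, imply `IsThin`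
  (`IsBridgeCut.isThin_of_conditions`).
* `IsThin` implies the fourth and the fifth condition: a path or a cycle that meets a side only in
  core nodes would contain a node with two neighbors in the core, and two nodes outside the core, on
  different sides, are avoided by one properly connected set
  (`IsBridgeCut.exists_properlyConnected_avoiding`).
* `IsThin` implies that the face is a facet (`IsBridgeCut.isFacet_of_isThin`). Given a valid
  equation, evaluate it at the vectors `cutVector G' U` of connected sets `U`. If `D` and its unions
  with `p` and `q` all yield vectors of the face, inclusion and exclusion shows that the coefficient
  at `pq` is zero (`coeff_eq_zero_of_insert`). For `p` and `q` on one side, `D` is the interior of a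
  path; for `p` and `q` on different sides and outside the core, `D` is a maximal properly connected
  set that avoids both. For a crossing edge between a node `p` outside the core and a core node, it
  suffices to compare a maximal properly connected set that avoids `p` with its union with `p`,
  because the coefficients at all other edges at `p` have been shown to vanish.
-/

namespace LiftedMulticut

/-! ### Connected node sets and walks -/

section Graph

variable {V : Type*} {G : SimpleGraph V}

lemma exists_walk_of_induce_preconnected {U : Set V} (hU : (G.induce U).Preconnected) {x y : V}
    (hx : x ∈ U) (hy : y ∈ U) : ∃ p : G.Walk x y, ∀ z ∈ p.support, z ∈ U := by
  obtain ⟨p⟩ := hU ⟨x, hx⟩ ⟨y, hy⟩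
  refine ⟨p.map ((SimpleGraph.Embedding.induce U).toHom : G.induce U →g G), fun z hz => ?_⟩
  obtain ⟨z', -, rfl⟩ := List.mem_map.1 ((SimpleGraph.Walk.support_map _ p) ▸ hz)
  exact z'.2

lemma induce_singleton_preconnected (x : V) : (G.induce {x}).Preconnected := by
  rintro ⟨y, rfl⟩ ⟨z, rfl⟩
  rfl

lemma induce_empty_preconnected : (G.induce (∅ : Set V)).Preconnected :=
  fun x => x.2.elim

lemma induce_insert_connected {U : Set V} (hU : (G.induce U).Preconnected) {x y : V}
    (hx : x ∈ U) (hxy : G.Adj x y) : (G.induce (insert y U)).Connected := by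
  rw [← Set.union_singleton]
  exact SimpleGraph.connected_induce_union hU (induce_singleton_preconnected y) hx rfl hxy

lemma mem_of_mem_edges_of_support_subset {x y : V} (p : G.Walk x y) {U : Set V}
    (h : ∀ z ∈ p.support, z ∈ U) {e : Sym2 V} (he : e ∈ p.edges) : ∀ u ∈ e, u ∈ U := by
  intro u hu
  obtain ⟨u', rfl⟩ := Sym2.mem_iff_exists.1 hu
  exact h _ (p.fst_mem_support_of_mem_edges he)

/-- A path between distinct nodes splits into its two end nodes and a connected (possibly empty)
set `D` of interior nodes, such that all four unions of `D` with end nodes are connected. -/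
lemma exists_interior {p q : V} (hpq : p ≠ q) (h : G.Reachable p q) :
    ∃ D : Set V, p ∉ D ∧ q ∉ D ∧ (∀ x ∈ D, G.Reachable p x) ∧
      (G.induce D).Preconnected ∧ (G.induce (insert p D)).Preconnected ∧
      (G.induce (insert q D)).Preconnected ∧ (G.induce (insert p (insert q D))).Preconnected := by
  classical
  obtain ⟨P, hP⟩ := h.exists_isPath
  cases P with
  | nil => exact absurd rfl hpq
  | @cons _ z _ hpz t =>
    rw [SimpleGraph.Walk.cons_isPath_iff] at hP
    obtain ⟨ht, hpt⟩ := hP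
    obtain ⟨r, hr⟩ : ∃ r : G.Walk q z, r = t.reverse := ⟨_, rfl⟩
    have hrp : r.IsPath := hr ▸ ht.reverse
    have hpr : p ∉ r.support := by simpa [hr] using hpt
    cases r with
    | nil =>
      refine ⟨∅, by simp, by simp, by simp, induce_empty_preconnected, ?_, ?_, ?_⟩
      · rw [insert_empty_eq]
        exact induce_singleton_preconnected p
      · rw [insert_empty_eq]
        exact induce_singleton_preconnected q
      · rw [insert_empty_eq]
        exact (SimpleGraph.induce_pair_connected_of_adj hpz).preconnected
    | @cons _ y _ hqy r =>
      rw [SimpleGraph.Walk.cons_isPath_iff] at hrp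
      rw [SimpleGraph.Walk.support_cons, List.mem_cons, not_or] at hpr
      have hD := r.connected_induce_support.preconnected
      refine ⟨{x | x ∈ r.support}, hpr.2, hrp.2, ?_, hD, ?_, ?_, ?_⟩
      · intro x hx
        exact hpz.reachable.trans ⟨(r.dropUntil x hx).reverse⟩
      · exact (induce_insert_connected hD r.end_mem_support hpz.symm).preconnected
      · exact (induce_insert_connected hD r.start_mem_support hqy.symm).preconnected
      · exact (induce_insert_connected
          (induce_insert_connected hD r.start_mem_support hqy.symm).preconnected
          (Or.inr r.end_mem_support) hpz.symm).preconnected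

/-- A connected set that avoids `Z` can be enlarged to one that still avoids `Z` and has no further
neighbors outside `Z`. -/
lemma exists_maximal_avoiding [Finite V] {U Z : Set V} (hU : (G.induce U).Connected)
    (hUZ : ∀ z ∈ Z, z ∉ U) :
    ∃ D : Set V, U ⊆ D ∧ (G.induce D).Connected ∧ (∀ z ∈ Z, z ∉ D) ∧
      ∀ x ∈ D, ∀ y, G.Adj x y → y ∉ D → y ∈ Z := by
  obtain ⟨D, hD, hmax⟩ := (Set.toFinite {D : Set V | U ⊆ D ∧ (G.induce D).Connected ∧
    ∀ z ∈ Z, z ∉ D}).exists_maximal ⟨U, subset_rfl, hU, hUZ⟩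
  refine ⟨D, hD.1, hD.2.1, hD.2.2, fun x hx y hxy hy => ?_⟩
  by_contra hyZ
  refine hy (hmax (y := insert y D) ⟨hD.1.trans (Set.subset_insert _ _),
    induce_insert_connected hD.2.1.preconnected hx hxy, ?_⟩ (Set.subset_insert _ _)
    (Set.mem_insert _ _))
  rintro z hz (rfl | h)
  · exact hyZ hz
  · exact hD.2.2 z hz h

lemma induce_reachable_connected {H : SimpleGraph V} (hH : H ≤ G) (x : V) :
    (G.induce {u | H.Reachable x u}).Connected := by
  refine SimpleGraph.induce_connected_of_patches x (SimpleGraph.Reachable.refl x) ?_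
  rintro u ⟨p⟩
  refine ⟨{y | y ∈ (p.mapLe hH).support}, fun y hy => ?_, SimpleGraph.Walk.start_mem_support _,
    SimpleGraph.Walk.end_mem_support _, (p.mapLe hH).connected_induce_support.preconnected _ _⟩
  classical
  simp only [SimpleGraph.Walk.support_mapLe_eq_support, Set.mem_ofPred_eq] at hy
  exact ⟨p.takeUntil y hy⟩

/-! ### Bridge cuts -/

/-- The situation of a cut that consists of a bridge `ab`: the deletion of `ab` leaves two
components, that of `v`, which contains `a`, and that of `w`, which contains `b`. -/
structure IsBridgeCut (G : SimpleGraph V) (v w a b : V) : Prop where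
  adj : G.Adj a b
  left : a ∈ side G {s(a, b)} v
  right : b ∈ side G {s(a, b)} w
  disjoint : ∀ u ∈ side G {s(a, b)} v, u ∉ side G {s(a, b)} w
  cover : ∀ u, u ∈ side G {s(a, b)} v ∨ u ∈ side G {s(a, b)} w

lemma self_mem_side (C : Set (Sym2 V)) (x : V) : x ∈ side G C x := by
  exact SimpleGraph.Reachable.refl x

lemma mem_side_of_adj {C : Set (Sym2 V)} {v x y : V} (hx : x ∈ side G C v) (hxy : G.Adj x y)
    (hC : s(x, y) ∉ C) : y ∈ side G C v :=
  SimpleGraph.Reachable.trans hx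
    (SimpleGraph.Adj.reachable ((SimpleGraph.deleteEdges_adj ..).2 ⟨hxy, hC⟩))

lemma IsCut.exists_isBridgeCut {v w : V} {e : Sym2 V} (hG : G.Connected)
    (hC : IsCut G v w {e}) : ∃ a b, e = s(a, b) ∧ IsBridgeCut G v w a b := by
  obtain ⟨hE, hvw, -⟩ := hC
  have key : ∀ {x y : V}, ¬ (G.deleteEdges {e}).Reachable x y → ∃ c d, G.Adj c d ∧ e = s(c, d) ∧
      c ∈ side G {e} x ∧ d ∉ side G {e} x := by
    intro x y hxy
    obtain ⟨p⟩ := hG.preconnected x y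
    obtain ⟨d, -, h1, h2⟩ := p.exists_boundary_dart (side G {e} x) (self_mem_side _ _) hxy
    refine ⟨d.fst, d.snd, d.adj, ?_, h1, h2⟩
    by_contra hne
    exact h2 (mem_side_of_adj h1 d.adj (fun h => hne h.symm))
  have hdis : ∀ u ∈ side G {e} v, u ∉ side G {e} w := fun u h1 h2 =>
    hvw (SimpleGraph.Reachable.trans h1 (SimpleGraph.Reachable.symm h2))
  obtain ⟨a, b, hab, rfl, ha, hb⟩ := key hvw
  obtain ⟨c, d, hcd, hcd', hc, hd⟩ := key (fun h => hvw h.symm)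
  have hbw : b ∈ side G {s(a, b)} w := by
    rcases Sym2.eq_iff.1 hcd' with ⟨rfl, rfl⟩ | ⟨rfl, rfl⟩
    · exact absurd hc (hdis _ ha)
    · exact hc
  refine ⟨a, b, rfl, hab, ha, hbw, hdis, fun u => ?_⟩
  by_contra! hu
  obtain ⟨c, d, hcd, hcd', hc, hd⟩ := key (x := u) (y := v) (fun h => hu.1 h.symm)
  rcases Sym2.eq_iff.1 hcd' with ⟨rfl, rfl⟩ | ⟨rfl, rfl⟩
  · exact hu.1 (SimpleGraph.Reachable.trans ha (SimpleGraph.Reachable.symm hc))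
  · exact hu.2 (SimpleGraph.Reachable.trans hbw (SimpleGraph.Reachable.symm hc))

namespace IsBridgeCut

variable {v w a b : V} (h : IsBridgeCut G v w a b)
include h

lemma symm : IsBridgeCut G w v b a := by
  have := Sym2.eq_swap (a := a) (b := b)
  exact ⟨h.adj.symm, this ▸ h.right, this ▸ h.left, this ▸ fun u h1 h2 => h.disjoint u h2 h1,
    this ▸ fun u => (h.cover u).symm⟩

lemma eq_of_adj {x y : V} (hx : x ∈ side G {s(a, b)} v) (hy : y ∈ side G {s(a, b)} w)
    (hxy : G.Adj x y) : x = a ∧ y = b := by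
  have : s(x, y) = s(a, b) := by
    by_contra hne
    exact h.disjoint _ (mem_side_of_adj hx hxy hne) hy
  rcases Sym2.eq_iff.1 this with h' | ⟨rfl, rfl⟩
  · exact h'
  · exact absurd h.right (h.disjoint _ hx)

/-- Along a walk that starts on the side of `v` and leaves it, the part before the bridge is a walk
to `a` on that side. -/
lemma exists_walk_left {x y : V} (p : G.Walk x y) (hx : x ∈ side G {s(a, b)} v)
    (hy : y ∈ side G {s(a, b)} w) :
    ∃ q : G.Walk x a, ∀ z ∈ q.support, z ∈ p.support ∧ z ∈ side G {s(a, b)} v := by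
  induction p with
  | nil => exact absurd hy (h.disjoint _ hx)
  | @cons x z y hxz p ih =>
    rcases h.cover z with hz | hz
    · obtain ⟨q, hq⟩ := ih hz hy
      refine ⟨q.cons hxz, fun u hu => ?_⟩
      rw [SimpleGraph.Walk.support_cons, List.mem_cons] at hu ⊢
      rcases hu with rfl | hu
      · exact ⟨Or.inl rfl, hx⟩
      · exact ⟨Or.inr (hq u hu).1, (hq u hu).2⟩
    · obtain ⟨rfl, -⟩ := h.eq_of_adj hx hz hxz
      refine ⟨SimpleGraph.Walk.nil, fun u hu => ?_⟩
      simp only [SimpleGraph.Walk.support_nil, List.mem_singleton] at hu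
      subst hu
      exact ⟨SimpleGraph.Walk.start_mem_support _, hx⟩

lemma exists_walk_right {x y : V} (p : G.Walk x y) (hx : x ∈ side G {s(a, b)} v)
    (hy : y ∈ side G {s(a, b)} w) :
    ∃ q : G.Walk y b, ∀ z ∈ q.support, z ∈ p.support ∧ z ∈ side G {s(a, b)} w := by
  have := h.symm.exists_walk_left p.reverse
  rw [Sym2.eq_swap] at this
  simpa using this hy hx

lemma ends_mem_support {x y : V} (p : G.Walk x y) (hx : x ∈ side G {s(a, b)} v)
    (hy : y ∈ side G {s(a, b)} w) : a ∈ p.support ∧ b ∈ p.support := by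
  obtain ⟨q, hq⟩ := h.exists_walk_left p hx hy
  obtain ⟨r, hr⟩ := h.exists_walk_right p hx hy
  exact ⟨(hq _ q.end_mem_support).1, (hr _ r.end_mem_support).1⟩

lemma ends_mem {U : Set V} (hU : (G.induce U).Preconnected) {x y : V} (hx : x ∈ U) (hy : y ∈ U)
    (hxv : x ∈ side G {s(a, b)} v) (hyw : y ∈ side G {s(a, b)} w) : a ∈ U ∧ b ∈ U := by
  obtain ⟨p, hp⟩ := exists_walk_of_induce_preconnected hU hx hy
  have := h.ends_mem_support p hxv hyw
  exact ⟨hp _ this.1, hp _ this.2⟩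

lemma properlyConnected_iff {U : Set V} :
    ProperlyConnected G v w {s(a, b)} U ↔ (G.induce U).Connected ∧ v ∈ U ∧ w ∈ U := by
  refine ⟨fun hU => ⟨hU.1, hU.2.1, hU.2.2.1⟩, fun hU => ⟨hU.1, hU.2.1, hU.2.2, ?_⟩⟩
  have hab := h.ends_mem hU.1.preconnected hU.2.1 hU.2.2 (self_mem_side _ _) (self_mem_side _ _)
  have : edgesIn G U ∩ {s(a, b)} = {s(a, b)} := by
    refine Set.inter_eq_right.2 ?_
    rintro _ rfl
    refine ⟨h.adj, fun u hu => ?_⟩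
    rcases Sym2.mem_iff.1 hu with rfl | rfl
    exacts [hab.1, hab.2]
  rw [this, Set.ncard_singleton]

lemma isCut (hG : G.Connected) {s t : V} (hs : s ∈ side G {s(a, b)} v)
    (ht : t ∈ side G {s(a, b)} w) : IsCut G s t {s(a, b)} := by
  refine ⟨Set.singleton_subset_iff.2 h.adj, fun hst => ?_, fun D hD => ?_⟩
  · exact h.disjoint t (SimpleGraph.Reachable.trans hs hst) ht
  · rw [Set.ssubset_singleton_iff.1 hD, SimpleGraph.deleteEdges_empty]
    exact hG.preconnected s t

lemma properlyConnected_univ (hG : G.Connected) :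
    ProperlyConnected G v w {s(a, b)} Set.univ := by
  rw [h.properlyConnected_iff]
  exact ⟨(SimpleGraph.induceUnivIso G).connected_iff.2 hG, trivial, trivial⟩

/-- The nodes that avoid some properly connected set can be avoided independently on the two sides
of the bridge. -/
lemma exists_properlyConnected_avoiding {p q : V} {U₁ U₂ : Set V}
    (h₁ : ProperlyConnected G v w {s(a, b)} U₁) (h₂ : ProperlyConnected G v w {s(a, b)} U₂)
    (hp : p ∈ side G {s(a, b)} v) (hq : q ∈ side G {s(a, b)} w) (hp₁ : p ∉ U₁) (hq₂ : q ∉ U₂) :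
    ∃ U, ProperlyConnected G v w {s(a, b)} U ∧ p ∉ U ∧ q ∉ U := by
  rw [h.properlyConnected_iff] at h₁ h₂
  obtain ⟨P₁, hP₁⟩ := exists_walk_of_induce_preconnected h₁.1.preconnected h₁.2.1 h₁.2.2
  obtain ⟨P₂, hP₂⟩ := exists_walk_of_induce_preconnected h₂.1.preconnected h₂.2.1 h₂.2.2
  obtain ⟨Q₁, hQ₁⟩ := h.exists_walk_left P₁ (self_mem_side _ _) (self_mem_side _ _)
  obtain ⟨Q₂, hQ₂⟩ := h.exists_walk_right P₂ (self_mem_side _ _) (self_mem_side _ _)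
  refine ⟨{x | x ∈ Q₁.support} ∪ {x | x ∈ Q₂.support}, h.properlyConnected_iff.2
    ⟨SimpleGraph.connected_induce_union Q₁.connected_induce_support.preconnected
      Q₂.connected_induce_support.preconnected Q₁.end_mem_support Q₂.end_mem_support h.adj,
      Or.inl Q₁.start_mem_support, Or.inr Q₂.start_mem_support⟩, ?_, ?_⟩
  · rintro (hp | hp')
    · exact hp₁ (hP₁ _ (hQ₁ _ hp).1)
    · exact h.disjoint _ hp (hQ₂ _ hp').2
  · rintro (hq' | hq)
    · exact h.disjoint _ (hQ₁ _ hq').2 hq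
    · exact hq₂ (hP₂ _ (hQ₂ _ hq).1)

end IsBridgeCut

end Graph

/-! ### The core of a bridge cut -/

section Core

variable {V : Type*} {G G' : SimpleGraph V} {v w a b : V}

/-- The nodes that lie in every properly `(vw, C)`-connected set. -/
def core (G : SimpleGraph V) (v w : V) (C : Set (Sym2 V)) : Set V :=
  {x | ∀ U, ProperlyConnected G v w C U → x ∈ U}

/-- The crossing edges are in general position with respect to the core: none of them joins two
core nodes, and no node is joined by two of them to core nodes. -/
structure IsThin (G G' : SimpleGraph V) (v w : V) (C : Set (Sym2 V)) : Prop where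
  not_mem_core : ∀ p q, s(p, q) ∈ crossing G G' v w C → p ∈ core G v w C → q ∉ core G v w C
  unique : ∀ p q₁ q₂, s(p, q₁) ∈ crossing G G' v w C → s(p, q₂) ∈ crossing G G' v w C →
    q₁ ∈ core G v w C → q₂ ∈ core G v w C → q₁ = q₂

lemma exists_avoiding_of_not_mem_core {C : Set (Sym2 V)} {p : V} (hp : p ∉ core G v w C) :
    ∃ U, ProperlyConnected G v w C U ∧ p ∉ U := by
  simpa [core] using hp

lemma crossingIn_eq_empty_of_improperlyConnected {C : Set (Sym2 V)} {U : Set V}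
    (hU : ImproperlyConnected G v w C U) : crossingIn G G' v w C U = ∅ := by
  refine Set.eq_empty_of_forall_notMem ?_
  rintro f ⟨⟨-, -, -, h1, h2⟩, hf⟩
  rcases hU.2 with h | h
  · exact h1 fun u hu => h (hf u hu)
  · exact h2 fun u hu => h (hf u hu)

lemma mem_crossingIn_mk {C : Set (Sym2 V)} {U : Set V} {p q : V}
    (hpq : s(p, q) ∈ crossing G G' v w C) :
    s(p, q) ∈ crossingIn G G' v w C U ↔ p ∈ U ∧ q ∈ U := by
  simp [crossingIn, hpq]

namespace IsBridgeCut

lemma sides_of_mem_crossing (h : IsBridgeCut G v w a b) {p q : V}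
    (hpq : s(p, q) ∈ crossing G G' v w {s(a, b)}) :
    (p ∈ side G {s(a, b)} v ∧ q ∈ side G {s(a, b)} w) ∨
      (p ∈ side G {s(a, b)} w ∧ q ∈ side G {s(a, b)} v) := by
  obtain ⟨-, -, -, h1, h2⟩ := hpq
  simp only [Sym2.mem_iff, forall_eq_or_imp, forall_eq] at h1 h2
  have := h.cover p
  have := h.cover q
  tauto

lemma mem_crossing (h : IsBridgeCut G v w a b) {p q : V} (hpq : G'.Adj p q)
    (hpv : p ∈ side G {s(a, b)} v) (hqw : q ∈ side G {s(a, b)} w) (hab : s(p, q) ≠ s(a, b)) (hne : s(p, q) ≠ s(v, w)) :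
    s(p, q) ∈ crossing G G' v w {s(a, b)} := by
  refine ⟨hpq, fun hadj => hab ?_, hne, fun hA => h.disjoint _ (hA q (by simp)) hqw,
    fun hB => h.disjoint _ hpv (hB p (by simp))⟩
  obtain ⟨rfl, rfl⟩ := h.eq_of_adj hpv hqw hadj
  rfl

lemma left_mem_core (h : IsBridgeCut G v w a b) : a ∈ core G v w {s(a, b)} := fun _ hU =>
  (h.ends_mem hU.1.preconnected hU.2.1 hU.2.2.1 (self_mem_side _ _) (self_mem_side _ _)).1

lemma right_mem_core (h : IsBridgeCut G v w a b) : b ∈ core G v w {s(a, b)} := fun _ hU =>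
  (h.ends_mem hU.1.preconnected hU.2.1 hU.2.2.1 (self_mem_side _ _) (self_mem_side _ _)).2

lemma properlyConnected_of_bridge_mem (h : IsBridgeCut G v w a b) {U : Set V}
    (hU : CutConnected G v w {s(a, b)} U) (hab : s(a, b) ∈ edgesIn G U) :
    ProperlyConnected G v w {s(a, b)} U := by
  refine hU.resolve_right fun hI => ?_
  have ha := hab.2 a (Sym2.mem_mk_left _ _)
  have hb := hab.2 b (Sym2.mem_mk_right _ _)
  rcases hI.2 with h' | h'
  · exact h.disjoint _ (h' hb) h.right
  · exact h.disjoint _ h.left (h' ha)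

lemma cutCondition1 (h : IsBridgeCut G v w a b) (hG : G.Connected) :
    CutCondition1 G v w {s(a, b)} := by
  rintro _ rfl
  exact ⟨Set.univ, Or.inl (h.properlyConnected_univ hG), h.adj, fun _ _ => trivial⟩

/-- A crossing edge between core nodes lies in all properly connected sets, which contradicts the
second condition for this single edge. Two crossing edges from one node to core nodes lie in the
same `(vw, C)`-connected sets, which contradicts the third condition for the one as `f'`, the other
as the only element of `F`, and `k = 1`. -/
lemma isThin_of_conditions (h : IsBridgeCut G v w a b) (h2 : CutCondition2 G G' v w {s(a, b)})
    (h3 : CutCondition3 G G' v w {s(a, b)}) : IsThin G G' v w {s(a, b)} := by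
  refine ⟨fun p q hpq hp hq => ?_, fun p q₁ q₂ hq₁ hq₂ hc₁ hc₂ => ?_⟩
  · obtain ⟨e, rfl, U₁, U₂, hU₁, hU₂, he₁, he₂, hne⟩ :=
      h2 {s(p, q)} (Set.singleton_nonempty _) (Set.singleton_subset_iff.2 hpq)
    have key : ∀ U, CutConnected G v w {s(a, b)} U → s(a, b) ∈ edgesIn G U →
        {s(p, q)} ∩ crossingIn G G' v w {s(a, b)} U = {s(p, q)} := by
      intro U hU he
      have hU' := h.properlyConnected_of_bridge_mem hU he
      exact Set.inter_eq_left.2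
        (Set.singleton_subset_iff.2 ((mem_crossingIn_mk hpq).2 ⟨hp U hU', hq U hU'⟩))
    exact hne (by rw [key _ hU₁ he₁, key _ hU₂ he₂])
  · by_contra hne
    obtain ⟨U₁, U₂, hU₁, hU₂, hf₁, hf₂, hk⟩ := h3 s(p, q₁) hq₁ {s(p, q₂)}
      (Set.singleton_nonempty _)
      (Set.singleton_subset_iff.2 ⟨hq₂, fun he => hne (Sym2.congr_right.1 he).symm⟩) 1
    have hP₁ : ProperlyConnected G v w {s(a, b)} U₁ := by
      refine hU₁.resolve_right fun hI => ?_
      rw [crossingIn_eq_empty_of_improperlyConnected hI] at hf₁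
      exact hf₁
    rcases hk with hk | hk
    · refine hk ?_
      rw [Set.inter_eq_left.2 (Set.singleton_subset_iff.2 ((mem_crossingIn_mk hq₂).2
        ⟨((mem_crossingIn_mk hq₁).1 hf₁).1, hc₂ U₁ hP₁⟩)), Set.ncard_singleton]
    · refine hk ?_
      suffices s(p, q₂) ∉ crossingIn G G' v w {s(a, b)} U₂ by
        rw [Set.singleton_inter_eq_empty.2 this, Set.ncard_empty]
      rcases hU₂ with hP₂ | hI
      · intro hp
        exact hf₂ ((mem_crossingIn_mk hq₁).2 ⟨((mem_crossingIn_mk hq₂).1 hp).1, hc₁ U₂ hP₂⟩)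
      · rw [crossingIn_eq_empty_of_improperlyConnected hI]
        exact id

lemma sides_of_crossingGraph_adj (h : IsBridgeCut G v w a b) {p q : V}
    (hpq : (crossingGraph G G' v w {s(a, b)}).Adj p q) :
    (p ∈ side G {s(a, b)} v ∧ q ∈ side G {s(a, b)} w) ∨
      (p ∈ side G {s(a, b)} w ∧ q ∈ side G {s(a, b)} v) := by
  rcases ((SimpleGraph.fromEdgeSet_adj _).1 hpq).1 with hc | he
  · exact h.sides_of_mem_crossing hc
  · rcases Sym2.eq_iff.1 he with ⟨rfl, rfl⟩ | ⟨rfl, rfl⟩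
    · exact Or.inl ⟨h.left, h.right⟩
    · exact Or.inr ⟨h.right, h.left⟩

end IsBridgeCut

lemma IsThin.eq_bridge_of_adj (ht : IsThin G G' v w {s(a, b)}) {p q : V}
    (hpq : (crossingGraph G G' v w {s(a, b)}).Adj p q) (hp : p ∈ core G v w {s(a, b)})
    (hq : q ∈ core G v w {s(a, b)}) : s(p, q) = s(a, b) := by
  rcases ((SimpleGraph.fromEdgeSet_adj _).1 hpq).1 with hc | he
  · exact absurd hq (ht.not_mem_core p q hc hp)
  · exact he

lemma IsThin.eq_of_adj (ht : IsThin G G' v w {s(a, b)}) (h : IsBridgeCut G v w a b) {p q₁ q₂ : V}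
    (h₁ : (crossingGraph G G' v w {s(a, b)}).Adj p q₁)
    (h₂ : (crossingGraph G G' v w {s(a, b)}).Adj p q₂)
    (hq₁ : q₁ ∈ core G v w {s(a, b)}) (hq₂ : q₂ ∈ core G v w {s(a, b)}) : q₁ = q₂ := by
  by_cases hp : p ∈ core G v w {s(a, b)}
  · exact Sym2.congr_right.1
      ((ht.eq_bridge_of_adj h₁ hp hq₁).trans (ht.eq_bridge_of_adj h₂ hp hq₂).symm)
  · have key : ∀ q, (crossingGraph G G' v w {s(a, b)}).Adj p q →
        s(p, q) ∈ crossing G G' v w {s(a, b)} := by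
      intro q hq
      refine ((SimpleGraph.fromEdgeSet_adj _).1 hq).1.resolve_right fun he => hp ?_
      rcases Sym2.eq_iff.1 he with ⟨rfl, -⟩ | ⟨rfl, -⟩
      · exact h.left_mem_core
      · exact h.right_mem_core
    exact ht.unique p q₁ q₂ (key _ h₁) (key _ h₂) hq₁ hq₂

/-- In a bipartite graph in which no node has two neighbors in `K`, no cycle has all its nodes of
one color in `K`. -/
lemma exists_mem_support_cycle {T : SimpleGraph V} {A B K : Set V}
    (hT : ∀ x y, T.Adj x y → x ∈ A ∧ y ∈ B ∨ x ∈ B ∧ y ∈ A) (hAB : ∀ x ∈ A, x ∉ B)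
    (hK : ∀ p q₁ q₂, T.Adj p q₁ → T.Adj p q₂ → q₁ ∈ K → q₂ ∈ K → q₁ = q₂)
    {y : V} (Y : T.Walk y y) (hY : Y.IsCycle) : ∃ x ∈ Y.support, x ∈ A ∧ x ∉ K := by
  by_contra! hcon
  obtain ⟨z, hz, hzB⟩ : ∃ z ∈ Y.support, z ∈ B := by
    have hadj := Y.adj_snd hY.not_nil
    rcases hT _ _ hadj with h | h
    · exact ⟨_, Y.getVert_mem_support _, h.2⟩
    · exact ⟨_, Y.start_mem_support, h.1⟩
  obtain ⟨q₁, q₂, hne, hq⟩ := Set.ncard_eq_two.1 (hY.ncard_neighborSet_toSubgraph_eq_two hz)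
  have key : ∀ q ∈ Y.toSubgraph.neighborSet z, T.Adj z q ∧ q ∈ K := by
    intro q hq
    have hadj : Y.toSubgraph.Adj z q := hq
    refine ⟨hadj.adj_sub, hcon q (Y.mem_support_of_adj_toSubgraph hadj.symm) ?_⟩
    rcases hT _ _ hadj.adj_sub with h | h
    · exact absurd hzB (hAB z h.1)
    · exact h.2
  have h₁ := key q₁ (by rw [hq]; simp)
  have h₂ := key q₂ (by rw [hq]; simp)
  exact hne (hK z q₁ q₂ h₁.1 h₂.1 h₁.2 h₂.2)

/-- In a bipartite graph in which no node has two neighbors in `K`, a path between nodes of `K` of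
different colors that is not a single edge has a node outside `K` of the color of its start. -/
lemma exists_mem_support_path {T : SimpleGraph V} {A B K : Set V}
    (hT : ∀ x y, T.Adj x y → x ∈ A ∧ y ∈ B ∨ x ∈ B ∧ y ∈ A) (hAB : ∀ x ∈ A, x ∉ B)
    (hK : ∀ p q₁ q₂, T.Adj p q₁ → T.Adj p q₂ → q₁ ∈ K → q₂ ∈ K → q₁ = q₂)
    {x y : V} (hx : x ∈ A) (hy : y ∈ B) (hxK : x ∈ K) (P : T.Walk x y) (hP : P.IsPath)
    (hlen : P.length ≠ 1) : ∃ z ∈ P.support, z ∈ A ∧ z ∉ K := by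
  by_contra! hcon
  cases P with
  | nil => exact hAB _ hx hy
  | @cons _ u _ hxu t =>
    cases t with
    | nil => simp at hlen
    | @cons _ z _ huz t =>
      have huB : u ∈ B := by
        rcases hT _ _ hxu with h | h
        · exact h.2
        · exact absurd h.1 (hAB _ hx)
      have hzA : z ∈ A := by
        rcases hT _ _ huz with h | h
        · exact absurd huB (hAB _ h.1)
        · exact h.2
      have hzK := hcon z (by simp) hzA
      have hxz := hK u x z hxu.symm huz hxK hzK
      subst hxz
      simp at hP

lemma IsThin.cutCondition5 (ht : IsThin G G' v w {s(a, b)}) (h : IsBridgeCut G v w a b) :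
    CutCondition5 G G' v w {s(a, b)} := by
  intro y Y hY
  obtain ⟨p, hp, hpA, hpK⟩ := exists_mem_support_cycle
    (fun _ _ => h.sides_of_crossingGraph_adj) h.disjoint (fun _ _ _ => ht.eq_of_adj h) Y hY
  obtain ⟨q, hq, hqB, hqK⟩ := exists_mem_support_cycle
    (fun _ _ hxy => (h.sides_of_crossingGraph_adj hxy).symm)
    (fun x hx hx' => h.disjoint x hx' hx) (fun _ _ _ => ht.eq_of_adj h) Y hY
  obtain ⟨U₁, hU₁, hp₁⟩ := exists_avoiding_of_not_mem_core hpK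
  obtain ⟨U₂, hU₂, hq₂⟩ := exists_avoiding_of_not_mem_core hqK
  obtain ⟨U, hU, hpU, hqU⟩ := h.exists_properlyConnected_avoiding hU₁ hU₂ hpA hqB hp₁ hq₂
  exact ⟨U, hU, ⟨p, hp, hpA, hpU⟩, ⟨q, hq, hqB, hqU⟩⟩

lemma IsThin.cutCondition4 (ht : IsThin G G' v w {s(a, b)}) (h : IsBridgeCut G v w a b) :
    CutCondition4 G G' v w {s(a, b)} := by
  intro v' hv' w' hw' P hP hne
  by_cases hvK : v' ∈ core G v w {s(a, b)}
  swap
  · obtain ⟨U, hU, hvU⟩ := exists_avoiding_of_not_mem_core hvK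
    exact ⟨U, hU, Or.inl hvU, Or.inr ⟨v', P.start_mem_support, hv', hvU⟩⟩
  by_cases hwK : w' ∈ core G v w {s(a, b)}
  swap
  · obtain ⟨U, hU, hwU⟩ := exists_avoiding_of_not_mem_core hwK
    exact ⟨U, hU, Or.inr ⟨w', P.end_mem_support, hw', hwU⟩, Or.inl hwU⟩
  have hlen : P.length ≠ 1 := by
    intro hl
    refine hne ⟨s(a, b), rfl, ?_⟩
    cases P with
    | nil => simp at hl
    | cons hadj t =>
      cases t with
      | nil => simpa using ht.eq_bridge_of_adj hadj hvK hwK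
      | cons _ _ => simp at hl
  obtain ⟨p, hp, hpA, hpK⟩ := exists_mem_support_path
    (fun _ _ => h.sides_of_crossingGraph_adj) h.disjoint (fun _ _ _ => ht.eq_of_adj h)
    hv' hw' hvK P hP hlen
  obtain ⟨q, hq, hqB, hqK⟩ := exists_mem_support_path
    (fun _ _ hxy => (h.sides_of_crossingGraph_adj hxy).symm)
    (fun x hx hx' => h.disjoint x hx' hx) (fun _ _ _ => ht.eq_of_adj h)
    hw' hv' hwK P.reverse hP.reverse (by simpa using hlen)
  rw [SimpleGraph.Walk.support_reverse, List.mem_reverse] at hq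
  obtain ⟨U₁, hU₁, hp₁⟩ := exists_avoiding_of_not_mem_core hpK
  obtain ⟨U₂, hU₂, hq₂⟩ := exists_avoiding_of_not_mem_core hqK
  obtain ⟨U, hU, hpU, hqU⟩ := h.exists_properlyConnected_avoiding hU₁ hU₂ hpA hqB hp₁ hq₂
  exact ⟨U, hU, Or.inr ⟨q, hq, hqB, hqU⟩, Or.inr ⟨p, hp, hpA, hpU⟩⟩

end Core

/-! ### Affine hulls, exposed faces and linear equations -/

section Linear

lemma vectorSpan_convexHull {E : Type*} [AddCommGroup E] [Module ℝ E] (S : Set E) :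
    vectorSpan ℝ (convexHull ℝ S) = vectorSpan ℝ S := by
  rw [← direction_affineSpan, affineSpan_convexHull, direction_affineSpan]

variable {ι : Type*} [Fintype ι]

/-- In coordinates: every linear equation that is valid on `S`, up to its right-hand side, vanishes
on the direction of the affine hull of `S`. -/
lemma sum_mul_eq_zero_of_mem_vectorSpan {S : Set (ι → ℝ)} {α : ι → ℝ} {β : ℝ}
    (h : ∀ x ∈ S, ∑ i, α i * x i = β) {z : ι → ℝ} (hz : z ∈ vectorSpan ℝ S) :
    ∑ i, α i * z i = 0 := by
  have hle : vectorSpan ℝ S ≤ LinearMap.ker (∑ i, α i • LinearMap.proj (R := ℝ)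
      (φ := fun _ : ι => ℝ) i) := by
    rw [vectorSpan_def, Submodule.span_le]
    rintro _ ⟨x, hx, y, hy, rfl⟩
    simp [mul_sub, Finset.sum_sub_distrib, h x hx, h y hy]
  simpa using hle hz

/-- The converse of `sum_mul_eq_zero_of_mem_vectorSpan`, by duality. -/
lemma mem_vectorSpan_of_forall_sum_mul_eq_zero {S : Set (ι → ℝ)} (hS : S.Nonempty) {z : ι → ℝ}
    (h : ∀ (α : ι → ℝ) (β : ℝ), (∀ x ∈ S, ∑ i, α i * x i = β) → ∑ i, α i * z i = 0) :
    z ∈ vectorSpan ℝ S := by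
  classical
  by_contra hz
  obtain ⟨φ, hφ, hmap⟩ := Submodule.exists_dual_map_eq_bot_of_notMem hz inferInstance
  have hsum : ∀ x : ι → ℝ, φ x = ∑ i, φ (Pi.single i 1) * x i := by
    intro x
    rw [LinearMap.pi_apply_eq_sum_univ φ x]
    refine Finset.sum_congr rfl fun i _ => ?_
    rw [smul_eq_mul, mul_comm]
    congr 2
    ext j
    simp [Pi.single_apply, eq_comm]
  obtain ⟨y, hy⟩ := hS
  refine hφ ?_
  rw [hsum]
  refine h _ (φ y) fun x hx => ?_
  rw [← hsum, ← sub_eq_zero, ← map_sub]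
  have hmem := Submodule.mem_map_of_mem (f := φ) (vsub_mem_vectorSpan ℝ hx hy)
  rw [hmap, Submodule.mem_bot] at hmem
  simpa using hmem

/-- A point of a convex hull at which a valid linear inequality is tight is a convex combination
of points at which it is tight. -/
lemma mem_convexHull_tight {E : Type*} [AddCommGroup E] [Module ℝ E] {X : Set E} (l : E →ₗ[ℝ] ℝ)
    (hl : ∀ x ∈ X, l x ≤ 0) {x : E} (hx : x ∈ convexHull ℝ X) (h0 : l x = 0) :
    x ∈ convexHull ℝ {y | y ∈ X ∧ l y = 0} := by
  suffices convexHull ℝ X ⊆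
      {x | l x ≤ 0 ∧ (l x = 0 → x ∈ convexHull ℝ {y | y ∈ X ∧ l y = 0})} from (this hx).2 h0
  refine convexHull_min (fun y hy => ⟨hl y hy, fun h => subset_convexHull ℝ _ ⟨hy, h⟩⟩) ?_
  rintro y ⟨hy, hy'⟩ z ⟨hz, hz'⟩ s t hs ht hst
  have h1 := mul_nonpos_of_nonneg_of_nonpos hs hy
  have h2 := mul_nonpos_of_nonneg_of_nonpos ht hz
  have hlin : l (s • y + t • z) = s * l y + t * l z := by simp
  refine ⟨by rw [hlin]; linarith, fun h => ?_⟩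
  rw [hlin] at h
  rcases eq_or_ne s 0 with rfl | hs0
  · have ht1 : t = 1 := by linarith
    subst ht1
    simpa using hz' (by linarith)
  rcases eq_or_ne t 0 with rfl | ht0
  · have hs1 : s = 1 := by linarith
    subst hs1
    simpa using hy' (by linarith)
  have hy0 : l y = 0 := (mul_eq_zero.1 (by linarith : s * l y = 0)).resolve_left hs0
  have hz0 : l z = 0 := (mul_eq_zero.1 (by linarith : t * l z = 0)).resolve_left ht0
  exact convex_convexHull ℝ _ (hy' hy0) (hz' hz0) hs ht hst

end Linear

/-! ### The vertices of the lifted multicut polytope -/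

section Vertices

variable {V : Type*} {G G' : SimpleGraph V}

open Classical in
/-- The characteristic vector of the lifted multicut of the decomposition of the graph into the
node set `U` and singletons: an edge has the value `0` if both its ends lie in `U`, and `1`
otherwise. -/
noncomputable def cutVector (G' : SimpleGraph V) (U : Set V) : G'.edgeSet → ℝ :=
  fun e => if ∀ u ∈ (e : Sym2 V), u ∈ U then 0 else 1

lemma cutVector_of_subset {U : Set V} {e : G'.edgeSet} (h : ∀ u ∈ (e : Sym2 V), u ∈ U) :
    cutVector G' U e = 0 := if_pos h

lemma cutVector_of_not_subset {U : Set V} {e : G'.edgeSet} {u : V} (hu : u ∈ (e : Sym2 V))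
    (hU : u ∉ U) : cutVector G' U e = 1 := if_neg fun h => hU (h u hu)

lemma cutVector_congr {U W : Set V} {e : G'.edgeSet}
    (h : (∀ u ∈ (e : Sym2 V), u ∈ U) ↔ ∀ u ∈ (e : Sym2 V), u ∈ W) :
    cutVector G' U e = cutVector G' W e := by
  unfold cutVector
  split_ifs with h₁ h₂ h₂
  · rfl
  · exact absurd (h.1 h₁) h₂
  · exact absurd (h.2 h₂) h₁
  · rfl

lemma cutVector_eq_zero_or_one (U : Set V) (e : G'.edgeSet) :
    cutVector G' U e = 0 ∨ cutVector G' U e = 1 := by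
  unfold cutVector
  split_ifs <;> simp

lemma cutVector_nonneg (U : Set V) (e : G'.edgeSet) : 0 ≤ cutVector G' U e := by
  rcases cutVector_eq_zero_or_one U e with h | h <;> simp [h]

lemma cutVector_le_one (U : Set V) (e : G'.edgeSet) : cutVector G' U e ≤ 1 := by
  rcases cutVector_eq_zero_or_one U e with h | h <;> simp [h]

open Classical in
/-- Inclusion and exclusion of two nodes isolates the edge between them. -/
lemma cutVector_inclusion_exclusion {D : Set V} {p q : V} (hp : p ∉ D) (hq : q ∉ D) (hpq : p ≠ q)
    (e : G'.edgeSet) :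
    cutVector G' (insert p D) e + cutVector G' (insert q D) e - cutVector G' D e
      - cutVector G' (insert p (insert q D)) e = if (e : Sym2 V) = s(p, q) then 1 else 0 := by
  obtain ⟨e, he⟩ := e
  induction e with
  | _ x y =>
    simp only [cutVector, Sym2.mem_iff, forall_eq_or_imp, forall_eq, Set.mem_insert_iff, Sym2.eq_iff]
    by_cases hxp : x = p <;> by_cases hxq : x = q <;> by_cases hyp : y = p <;>
      by_cases hyq : y = q <;> by_cases hx : x ∈ D <;> by_cases hy : y ∈ D <;> simp_all

/-- The instances are implicit variables, so that the lemma applies to whichever instances a sum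
over a singleton cut was written with. -/
lemma sum_singleton_cut {_ : Fintype G'.edgeSet} {M : Type*} [AddCommMonoid M] (f : G'.edgeSet → M)
    {e : Sym2 V} (he : e ∈ G'.edgeSet)
    {_ : DecidablePred fun e' : G'.edgeSet => (e' : Sym2 V) ∈ ({e} : Set (Sym2 V))} :
    ∑ e' ∈ Finset.univ.filter (fun e' : G'.edgeSet => (e' : Sym2 V) ∈ ({e} : Set (Sym2 V))), f e' =
      f ⟨e, he⟩ := by
  have : Finset.univ.filter
      (fun e' : G'.edgeSet => (e' : Sym2 V) ∈ ({e} : Set (Sym2 V))) = {⟨e, he⟩} := by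
    ext e'
    simp [Subtype.ext_iff]
  rw [this, Finset.sum_singleton]

/-- The spanning subgraph of `G` of those edges that a lifted multicut `x` does not cut. -/
def uncutGraph (G : SimpleGraph V) (x : G'.edgeSet → ℝ) : SimpleGraph V :=
  G.deleteEdges {e | ∃ h : e ∈ G'.edgeSet, x ⟨e, h⟩ = 1}

lemma uncutGraph_le (x : G'.edgeSet → ℝ) : uncutGraph G x ≤ G :=
  SimpleGraph.deleteEdges_le _

variable [Fintype V]

lemma cutVector_mem_vertices (hGG' : G ≤ G') {U : Set V} (hU : (G.induce U).Preconnected) :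
    cutVector G' U ∈ vertices G G' := by
  classical
  refine ⟨cutVector_eq_zero_or_one U, ?_, ?_, ?_⟩
  · intro y Y hY e he
    by_cases heU : ∀ u ∈ (e : Sym2 V), u ∈ U
    · rw [cutVector_of_subset heU]
      exact Finset.sum_nonneg fun _ _ => cutVector_nonneg _ _
    push Not at heU
    obtain ⟨u, hue, huU⟩ := heU
    -- The other edge of the cycle at the node `u` has the value `1` as well.
    obtain ⟨e', he', hue', hne⟩ : ∃ e' ∈ Y.edges, u ∈ e' ∧ e' ≠ e := by
      obtain ⟨z, hz⟩ := Sym2.mem_iff_exists.1 hue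
      have huY : u ∈ Y.support := Y.fst_mem_support_of_mem_edges (hz ▸ he)
      obtain ⟨r, hr, hrz⟩ := Set.exists_ne_of_one_lt_ncard
        (by rw [hY.ncard_neighborSet_toSubgraph_eq_two huY]; norm_num :
          1 < (Y.toSubgraph.neighborSet u).ncard) z
      refine ⟨s(u, r), SimpleGraph.Walk.adj_toSubgraph_iff_mem_edges.1 hr, by simp, fun h => ?_⟩
      rw [hz] at h
      exact hrz (Sym2.congr_right.1 h)
    have he'' : e' ∈ G'.edgeSet :=
      SimpleGraph.edgeSet_mono hGG' (Y.edges_subset_edgeSet he')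
    have h1 := Finset.single_le_sum (f := cutVector G' U)
      (s := Finset.univ.filter (fun e' : G'.edgeSet => (e' : Sym2 V) ∈ Y.edges ∧ e' ≠ e))
      (fun _ _ => cutVector_nonneg _ _) (a := ⟨e', he''⟩)
      (by simpa [Subtype.ext_iff] using ⟨he', hne⟩)
    rw [cutVector_of_not_subset (e := ⟨e', he''⟩) hue' huU] at h1
    exact (cutVector_le_one _ _).trans h1
  · intro s t f hf hfG P hP
    by_cases hfU : ∀ u ∈ (f : Sym2 V), u ∈ U
    · rw [cutVector_of_subset hfU]
      exact Finset.sum_nonneg fun _ _ => cutVector_nonneg _ _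
    push Not at hfU
    obtain ⟨u, huf, huU⟩ := hfU
    have hst : s ≠ t := by
      have := f.2
      rw [hf] at this
      exact G'.ne_of_adj this
    have huP : u ∈ P.support := by
      rw [hf] at huf
      rcases Sym2.mem_iff.1 huf with rfl | rfl
      exacts [P.start_mem_support, P.end_mem_support]
    obtain ⟨e', he', hue'⟩ := (SimpleGraph.Walk.mem_support_iff_exists_mem_edges_of_not_nil
      (SimpleGraph.Walk.not_nil_of_ne hst)).1 huP
    have he'' : e' ∈ G'.edgeSet :=
      SimpleGraph.edgeSet_mono hGG' (P.edges_subset_edgeSet he')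
    have h1 := Finset.single_le_sum (f := cutVector G' U)
      (s := Finset.univ.filter (fun e' : G'.edgeSet => (e' : Sym2 V) ∈ P.edges))
      (fun _ _ => cutVector_nonneg _ _) (a := ⟨e', he''⟩) (by simpa using he')
    rw [cutVector_of_not_subset (e := ⟨e', he''⟩) hue' huU] at h1
    exact (cutVector_le_one _ _).trans h1
  · intro s t f hf hfG C hC
    have hnn : ∀ e : G'.edgeSet, 0 ≤ 1 - cutVector G' U e :=
      fun e => sub_nonneg.2 (cutVector_le_one _ _)
    by_cases hfU : ∀ u ∈ (f : Sym2 V), u ∈ U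
    swap
    · push Not at hfU
      obtain ⟨u, huf, huU⟩ := hfU
      rw [cutVector_of_not_subset huf huU, sub_self]
      exact Finset.sum_nonneg fun _ _ => hnn _
    rw [hf] at hfU
    obtain ⟨P, hP⟩ := exists_walk_of_induce_preconnected hU (hfU s (by simp)) (hfU t (by simp))
    obtain ⟨e', he', heC⟩ : ∃ e' ∈ P.edges, e' ∈ C := by
      by_contra! hcon
      exact hC.2.1 ⟨P.toDeleteEdges C hcon⟩
    have he'' : e' ∈ G'.edgeSet :=
      SimpleGraph.edgeSet_mono hGG' (P.edges_subset_edgeSet he')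
    have h1 := Finset.single_le_sum (f := fun e => 1 - cutVector G' U e)
      (s := Finset.univ.filter (fun e' : G'.edgeSet => (e' : Sym2 V) ∈ C))
      (fun _ _ => hnn _) (a := ⟨e', he''⟩) (by simpa using heC)
    rw [cutVector_of_subset (e := ⟨e', he''⟩)
      (mem_of_mem_edges_of_support_subset P hP he'), sub_zero] at h1
    linarith [cutVector_nonneg U f]

/-- The path and cut inequalities say that an additional edge has the value `0` if and only if its
ends are connected by uncut edges. -/
lemma eq_zero_iff_reachable {x : G'.edgeSet → ℝ} (hx : x ∈ vertices G G') {s t : V}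
    {f : G'.edgeSet} (hf : (f : Sym2 V) = s(s, t)) (hfG : (f : Sym2 V) ∉ G.edgeSet) :
    x f = 0 ↔ (uncutGraph G x).Reachable s t := by
  classical
  obtain ⟨h01, -, hpath, hcut⟩ := hx
  constructor
  · intro h0
    by_contra hr
    obtain ⟨D, ⟨hDZ, hDr⟩, hmin⟩ := (Set.toFinite {D : Set (Sym2 V) |
      D ⊆ {e | ∃ h : e ∈ G'.edgeSet, x ⟨e, h⟩ = 1} ∩ G.edgeSet ∧
        ¬ (G.deleteEdges D).Reachable s t}).exists_minimal
      ⟨_, subset_rfl, by rw [uncutGraph, SimpleGraph.deleteEdges_eq_inter_edgeSet] at hr; exact hr⟩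
    have hD : IsCut G s t D := by
      refine ⟨fun e he => (hDZ he).2, hDr, fun D' hD' => ?_⟩
      by_contra hr'
      exact hD'.2 (hmin ⟨hD'.1.trans hDZ, hr'⟩ hD'.1)
    have h1 := hcut s t f hf hfG D hD
    rw [h0, Finset.sum_eq_zero] at h1
    · norm_num at h1
    · intro e he
      obtain ⟨_, h⟩ := (hDZ (Finset.mem_filter.1 he).2).1
      rw [h, sub_self]
  · intro hr
    obtain ⟨P, hP⟩ := hr.exists_isPath
    have h1 := hpath s t f hf hfG (P.mapLe (uncutGraph_le x))
      ((SimpleGraph.Walk.isPath_mapLe _).2 hP)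
    rw [Finset.sum_eq_zero] at h1
    · rcases h01 f with h | h
      · exact h
      · linarith
    · intro e he
      have he' := (Finset.mem_filter.1 he).2
      rw [SimpleGraph.Walk.edges_mapLe_eq_edges] at he'
      have := P.edges_subset_edgeSet he'
      rw [uncutGraph, SimpleGraph.edgeSet_deleteEdges] at this
      exact (h01 e).resolve_right fun h => this.2 ⟨e.2, h⟩

end Vertices

/-! ### The vertices of the face of a bridge cut -/

section Face

open scoped Classical

variable {V : Type*} [Fintype V] {G G' : SimpleGraph V} {v w a b : V}

lemma mem_cutFaceVertices_iff {f e : G'.edgeSet} {x : G'.edgeSet → ℝ} :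
    x ∈ cutFaceVertices G G' f {(e : Sym2 V)} ↔ x ∈ vertices G G' ∧ x f = x e := by
  simp only [cutFaceVertices, Set.mem_ofPred_eq]
  rw [sum_singleton_cut (fun e => 1 - x e) e.2, sub_right_inj]

namespace IsBridgeCut

variable (h : IsBridgeCut G v w a b)
include h

lemma cutVector_mem_face (hGG' : G ≤ G') (hvw' : G'.Adj v w) {U : Set V}
    (hU : (G.induce U).Preconnected)
    (hU' : (v ∈ U ∧ w ∈ U) ∨ U ⊆ side G {s(a, b)} v ∨ U ⊆ side G {s(a, b)} w) :
    cutVector G' U ∈ cutFaceVertices G G' ⟨s(v, w), hvw'⟩ {s(a, b)} := by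
  refine (mem_cutFaceVertices_iff (e := ⟨s(a, b), hGG' h.adj⟩)).2
    ⟨cutVector_mem_vertices hGG' hU, ?_⟩
  rcases hU' with ⟨hv, hw⟩ | hU' | hU'
  · obtain ⟨ha, hb⟩ := h.ends_mem hU hv hw (self_mem_side _ _) (self_mem_side _ _)
    rw [cutVector_of_subset (by simp [hv, hw]), cutVector_of_subset (by simp [ha, hb])]
  · rw [cutVector_of_not_subset (u := w) (by simp)
        (fun hw => h.disjoint _ (hU' hw) (self_mem_side _ _)),
      cutVector_of_not_subset (u := b) (by simp) (fun hb => h.disjoint _ (hU' hb) h.right)]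
  · rw [cutVector_of_not_subset (u := v) (by simp)
        (fun hv => h.disjoint _ (self_mem_side _ _) (hU' hv)),
      cutVector_of_not_subset (u := a) (by simp) (fun ha => h.disjoint _ h.left (hU' ha))]

lemma face_nonempty (hGG' : G ≤ G') (hvw' : G'.Adj v w) :
    (cutFaceVertices G G' ⟨s(v, w), hvw'⟩ {s(a, b)}).Nonempty :=
  ⟨_, h.cutVector_mem_face hGG' hvw' induce_empty_preconnected (Or.inr (Or.inl (by simp)))⟩

lemma le_of_mem_vertices (hGG' : G ≤ G') (hvw' : G'.Adj v w) (hG : G.Connected)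
    (hvw : ¬ G.Adj v w) {x : G'.edgeSet → ℝ} (hx : x ∈ vertices G G') : x ⟨s(a, b), hGG' h.adj⟩ ≤ x ⟨s(v, w), hvw'⟩ := by
  have := hx.2.2.2 v w ⟨s(v, w), hvw'⟩ rfl hvw _
    (h.isCut hG (self_mem_side _ _) (self_mem_side _ _))
  rw [sum_singleton_cut (fun e => 1 - x e) (e := s(a, b)) (hGG' h.adj)] at this
  linarith

lemma eq_zero_iff_of_mem_crossing {x : G'.edgeSet → ℝ} (hx : x ∈ vertices G G')
    (hr : (uncutGraph G x).Reachable v w) {f : G'.edgeSet}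
    (hf : (f : Sym2 V) ∈ crossing G G' v w {s(a, b)}) :
    x f = 0 ↔ ∀ u ∈ (f : Sym2 V), (uncutGraph G x).Reachable v u := by
  classical
  have key : ∀ {s t : V}, s ∈ side G {s(a, b)} v → t ∈ side G {s(a, b)} w →
      (uncutGraph G x).Reachable s t → (uncutGraph G x).Reachable s a := by
    rintro s t hs ht ⟨P⟩
    have := (h.ends_mem_support (P.mapLe (uncutGraph_le x)) hs ht).1
    rw [SimpleGraph.Walk.support_mapLe_eq_support] at this
    exact ⟨P.takeUntil a this⟩
  obtain ⟨s, t, hst⟩ : ∃ s t, (f : Sym2 V) = s(s, t) := by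
    induction (f : Sym2 V) with | _ s t => exact ⟨s, t, rfl⟩
  rw [eq_zero_iff_reachable hx hst hf.2.1, hst]
  rw [hst] at hf
  have hva := key (self_mem_side _ _) (self_mem_side _ _) hr
  simp only [Sym2.mem_iff, forall_eq_or_imp, forall_eq]
  refine ⟨fun hr' => ?_, fun hr' => hr'.1.symm.trans hr'.2⟩
  rcases h.sides_of_mem_crossing hf with ⟨hs, ht⟩ | ⟨hs, ht⟩
  · have := hva.trans (key hs ht hr').symm
    exact ⟨this, this.trans hr'⟩
  · have := hva.trans (key ht hs hr'.symm).symm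
    exact ⟨this.trans hr'.symm, this⟩

/-- On the crossing edges and the bridge, a vertex of the face is determined by a
`(vw, C)`-connected set, whose edges are those of value `0`. -/
lemma exists_cutConnected_of_mem_face (hGG' : G ≤ G') (hvw' : G'.Adj v w) 
    (hG : G.Connected) (hvw : ¬ G.Adj v w)
    {x : G'.edgeSet → ℝ} (hx : x ∈ cutFaceVertices G G' ⟨s(v, w), hvw'⟩ {s(a, b)}) :
    ∃ U, CutConnected G v w {s(a, b)} U ∧
      (1 - x ⟨s(a, b), hGG' h.adj⟩ = if s(a, b) ∈ edgesIn G U then 1 else 0) ∧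
      ∀ f : G'.edgeSet, (f : Sym2 V) ∈ crossing G G' v w {s(a, b)} →
        1 - x f = if (f : Sym2 V) ∈ crossingIn G G' v w {s(a, b)} U then 1 else 0 := by
  obtain ⟨hx, heq⟩ := (mem_cutFaceVertices_iff (e := ⟨s(a, b), hGG' h.adj⟩)).1 hx
  rcases hx.1 ⟨s(a, b), hGG' h.adj⟩ with h0 | h1
  · have hr := (eq_zero_iff_reachable (f := ⟨s(v, w), hvw'⟩) hx rfl hvw).1 (heq.trans h0)
    have hP : ProperlyConnected G v w {s(a, b)} {u | (uncutGraph G x).Reachable v u} :=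
      h.properlyConnected_iff.2
        ⟨induce_reachable_connected (uncutGraph_le x) v, SimpleGraph.Reachable.refl v, hr⟩
    refine ⟨_, Or.inl hP, ?_, fun f hf => ?_⟩
    · rw [h0, sub_zero, if_pos]
      refine ⟨h.adj, fun u hu => ?_⟩
      rcases Sym2.mem_iff.1 hu with rfl | rfl
      exacts [h.left_mem_core _ hP, h.right_mem_core _ hP]
    · have hiff := h.eq_zero_iff_of_mem_crossing hx hr hf
      split_ifs with hU
      · rw [hiff.2 hU.2, sub_zero]
      · rw [(hx.1 f).resolve_left fun hf0 => hU ⟨hf, hiff.1 hf0⟩, sub_self]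
  · have hI : ImproperlyConnected G v w {s(a, b)} {a} :=
      ⟨⟨induce_singleton_preconnected a⟩, Or.inl (Set.singleton_subset_iff.2 h.left)⟩
    refine ⟨{a}, Or.inr hI, ?_, fun f hf => ?_⟩
    · rw [h1, if_neg fun he => h.adj.ne' (he.2 b (Sym2.mem_mk_right _ _)), sub_self]
    · rw [crossingIn_eq_empty_of_improperlyConnected hI, if_neg (Set.notMem_empty _)]
      obtain ⟨s, t, hst, hs, ht⟩ : ∃ s t, (f : Sym2 V) = s(s, t) ∧ s ∈ side G {s(a, b)} v ∧
          t ∈ side G {s(a, b)} w := by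
        induction hf' : (f : Sym2 V) with
        | _ s t =>
          rw [hf'] at hf
          rcases h.sides_of_mem_crossing hf with h' | h'
          · exact ⟨s, t, rfl, h'.1, h'.2⟩
          · exact ⟨t, s, Sym2.eq_swap, h'.2, h'.1⟩
      have hcut := hx.2.2.2 s t f hst hf.2.1 _ (h.isCut hG hs ht)
      rw [sum_singleton_cut (fun e => 1 - x e) (e := s(a, b)) (hGG' h.adj), h1] at hcut
      rcases hx.1 f with hf0 | hf1
      · rw [hf0] at hcut
        norm_num at hcut
      · rw [hf1, sub_self]

end IsBridgeCut

/-! ### Dimension of the polytope and characterization of facets -/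

lemma sum_mul_ite_eq {p q : V} (α : G'.edgeSet → ℝ) (hpq : G'.Adj p q) :
    ∑ e : G'.edgeSet, α e * (if (e : Sym2 V) = s(p, q) then 1 else 0) = α ⟨s(p, q), hpq⟩ := by
  rw [Finset.sum_eq_single ⟨s(p, q), hpq⟩]
  · simp
  · intro e _ he
    rw [if_neg fun h => he (Subtype.ext h), mul_zero]
  · simp

/-- If an equation holds for the four vectors that belong to a set `D` and its unions with `p` and
`q`, then its coefficient at the edge `pq` is zero. -/
lemma coeff_eq_zero_of_insert {α : G'.edgeSet → ℝ} {β : ℝ} {D : Set V} {p q : V}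
    (hp : p ∉ D) (hq : q ∉ D) (hpq : G'.Adj p q)
    (h₀ : ∑ e, α e * cutVector G' D e = β) (h₁ : ∑ e, α e * cutVector G' (insert p D) e = β)
    (h₂ : ∑ e, α e * cutVector G' (insert q D) e = β)
    (h₃ : ∑ e, α e * cutVector G' (insert p (insert q D)) e = β) :
    α ⟨s(p, q), hpq⟩ = 0 := by
  classical
  rw [← sum_mul_ite_eq α hpq]
  simp_rw [← cutVector_inclusion_exclusion hp hq hpq.ne, mul_sub, mul_add, Finset.sum_sub_distrib,
    Finset.sum_add_distrib, h₀, h₁, h₂, h₃]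
  ring

/-- The lifted multicut polytope of a connected graph is full-dimensional. -/
lemma vectorSpan_vertices (hG : G.Connected) (hGG' : G ≤ G') :
    vectorSpan ℝ (vertices G G') = ⊤ := by
  refine eq_top_iff.2 fun z _ => mem_vectorSpan_of_forall_sum_mul_eq_zero
    ⟨_, cutVector_mem_vertices hGG' induce_empty_preconnected⟩ fun α β hα => ?_
  refine Finset.sum_eq_zero fun e _ => ?_
  suffices α e = 0 by rw [this, zero_mul]
  obtain ⟨e, he⟩ := e
  induction e with
  | _ p q =>
    obtain ⟨D, hp, hq, -, h₀, h₁, h₂, h₃⟩ :=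
      exists_interior (G'.ne_of_adj he) (hG.preconnected p q)
    exact coeff_eq_zero_of_insert hp hq he (hα _ (cutVector_mem_vertices hGG' h₀))
      (hα _ (cutVector_mem_vertices hGG' h₁)) (hα _ (cutVector_mem_vertices hGG' h₂))
      (hα _ (cutVector_mem_vertices hGG' h₃))

namespace IsBridgeCut

variable (h : IsBridgeCut G v w a b)
include h

lemma isExposed_cutFace (hGG' : G ≤ G') (hvw' : G'.Adj v w) (hG : G.Connected)
    (hvw : ¬ G.Adj v w) :
    IsExposed ℝ (polytope G G') (cutFace G G' ⟨s(v, w), hvw'⟩ {s(a, b)}) := by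
  rintro -
  let l : StrongDual ℝ (G'.edgeSet → ℝ) := ContinuousLinearMap.proj ⟨s(a, b), hGG' h.adj⟩ -
    ContinuousLinearMap.proj ⟨s(v, w), hvw'⟩
  have hl : ∀ x, l x = x ⟨s(a, b), hGG' h.adj⟩ - x ⟨s(v, w), hvw'⟩ := fun x => rfl
  have hle : ∀ x ∈ vertices G G', l x ≤ 0 := fun x hx =>
    sub_nonpos.2 (h.le_of_mem_vertices hGG' hvw' hG hvw hx)
  have hface : cutFaceVertices G G' ⟨s(v, w), hvw'⟩ {s(a, b)} =
      {x | x ∈ vertices G G' ∧ l x = 0} := by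
    ext x
    rw [mem_cutFaceVertices_iff (e := ⟨s(a, b), hGG' h.adj⟩), Set.mem_ofPred_eq, hl, sub_eq_zero,
      eq_comm (a := x ⟨s(v, w), hvw'⟩)]
  have hle' : ∀ x ∈ polytope G G', l x ≤ 0 := fun x hx =>
    convexHull_min (t := {x | l x ≤ 0}) hle
      (convex_halfSpace_le l.toLinearMap.isLinear 0) hx
  refine ⟨l, Set.Subset.antisymm (fun x hx => ?_) fun x hx => ?_⟩
  · have h0 : l x = 0 := convexHull_min (t := {x | l x = 0}) (by rw [hface]; exact fun y hy => hy.2)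
      (convex_hyperplane l.toLinearMap.isLinear 0) hx
    refine ⟨convexHull_mono (fun y hy => hy.1) hx, fun y hy => ?_⟩
    rw [h0]
    exact hle' y hy
  · obtain ⟨y, hy⟩ := h.face_nonempty hGG' hvw'
    have h0 : l x = 0 := by
      refine le_antisymm (hle' x hx.1) ?_
      have := hx.2 y (subset_convexHull ℝ _ hy.1)
      rw [hface] at hy
      rwa [hy.2] at this
    rw [cutFace, hface]
    exact mem_convexHull_tight l.toLinearMap hle hx.1 h0

/-- The face is a facet if and only if `x_{vw} = x_{ab}` is the only equation that it satisfies, up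
to scaling. -/
lemma isFacet_iff (hGG' : G ≤ G') (hvw' : G'.Adj v w) (hG : G.Connected)
    (hvw : ¬ G.Adj v w) :
    IsFacet (polytope G G') (cutFace G G' ⟨s(v, w), hvw'⟩ {s(a, b)}) ↔
      ∀ (α : G'.edgeSet → ℝ) (β : ℝ),
        (∀ x ∈ cutFaceVertices G G' ⟨s(v, w), hvw'⟩ {s(a, b)}, ∑ e, α e * x e = β) →
        ∀ e : G'.edgeSet, (e : Sym2 V) ≠ s(a, b) → (e : Sym2 V) ≠ s(v, w) → α e = 0 := by
  classical
  set ebar : G'.edgeSet := ⟨s(a, b), hGG' h.adj⟩ with hebar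
  set f : G'.edgeSet := ⟨s(v, w), hvw'⟩ with hf
  have hne : ebar ≠ f := by
    intro he
    have h1 : s(a, b) = s(v, w) := congrArg Subtype.val he
    exact hvw (by rw [← SimpleGraph.mem_edgeSet, ← h1]; exact h.adj)
  let l : Module.Dual ℝ (G'.edgeSet → ℝ) :=
    LinearMap.proj (R := ℝ) (φ := fun _ : G'.edgeSet => ℝ) ebar -
    LinearMap.proj (R := ℝ) (φ := fun _ : G'.edgeSet => ℝ) f
  have hl : ∀ x, l x = x ebar - x f := fun x => rfl
  have hl0 : l ≠ 0 := by
    intro h0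
    have := hl (Pi.single ebar 1)
    rw [h0] at this
    simp [Pi.single_eq_of_ne hne.symm] at this
  have hle : vectorSpan ℝ (cutFaceVertices G G' f {s(a, b)}) ≤ LinearMap.ker l := by
    rw [vectorSpan_def, Submodule.span_le]
    rintro _ ⟨x, hx, y, hy, rfl⟩
    have hx' := ((mem_cutFaceVertices_iff (e := ebar)).1 hx).2
    have hy' := ((mem_cutFaceVertices_iff (e := ebar)).1 hy).2
    rw [SetLike.mem_coe, LinearMap.mem_ker, hl]
    simp [hx', hy']
  have hdim := Module.Dual.finrank_ker_add_one_of_ne_zero hl0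
  have hfacet : IsFacet (polytope G G') (cutFace G G' f {s(a, b)}) ↔
      vectorSpan ℝ (cutFaceVertices G G' f {s(a, b)}) = LinearMap.ker l := by
    rw [IsFacet, polytope, cutFace, vectorSpan_convexHull, vectorSpan_convexHull,
      vectorSpan_vertices hG hGG', finrank_top]
    constructor
    · rintro ⟨-, -, hr⟩
      exact Submodule.eq_of_le_of_finrank_eq hle (by omega)
    · intro he
      exact ⟨(h.face_nonempty hGG' hvw').mono (subset_convexHull ℝ _),
        h.isExposed_cutFace hGG' hvw' hG hvw, by rw [he]; exact hdim⟩
  rw [hfacet]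
  constructor
  · intro he α β hα e he₁ he₂
    have hmem : Pi.single e 1 ∈ vectorSpan ℝ (cutFaceVertices G G' f {s(a, b)}) := by
      rw [he, LinearMap.mem_ker, hl, Pi.single_eq_of_ne, Pi.single_eq_of_ne, sub_zero]
      · rintro rfl
        exact he₂ rfl
      · rintro rfl
        exact he₁ rfl
    simpa [Pi.single_apply] using sum_mul_eq_zero_of_mem_vectorSpan hα hmem
  · intro H
    refine le_antisymm hle fun z hz => mem_vectorSpan_of_forall_sum_mul_eq_zero
      (h.face_nonempty hGG' hvw') fun α β hα => ?_
    have hα0 := H α β hα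
    have hsum : ∀ x : G'.edgeSet → ℝ, ∑ e, α e * x e = α ebar * x ebar + α f * x f := by
      intro x
      rw [← Finset.sum_subset (Finset.subset_univ {ebar, f}), Finset.sum_pair hne]
      intro e _ he
      simp only [Finset.mem_insert, Finset.mem_singleton, not_or] at he
      rw [hα0 e (fun h => he.1 (Subtype.ext h)) (fun h => he.2 (Subtype.ext h)), zero_mul]
    -- The vectors `0` and `1` both lie in the face, so the two remaining coefficients cancel.
    have h0 := hα _ (h.cutVector_mem_face hGG' hvw' (h.properlyConnected_univ hG).1.preconnected
      (Or.inl ⟨trivial, trivial⟩))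
    have h1 := hα _ (h.cutVector_mem_face hGG' hvw' induce_empty_preconnected
      (Or.inr (Or.inl (Set.empty_subset _))))
    rw [hsum] at h0 h1 ⊢
    rw [cutVector_of_subset fun _ _ => Set.mem_univ _,
      cutVector_of_subset fun _ _ => Set.mem_univ _] at h0
    rw [cutVector_of_not_subset (u := a) (Sym2.mem_mk_left _ _) (Set.notMem_empty _),
      cutVector_of_not_subset (u := v) (Sym2.mem_mk_left _ _) (Set.notMem_empty _)] at h1
    rw [LinearMap.mem_ker, hl] at hz
    rw [sub_eq_zero.1 hz]
    linear_combination z f * (h1 - h0)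

end IsBridgeCut

end Face

/-! ### Equations from violated conditions -/

section Facet

open scoped Classical

variable {V : Type*} [Fintype V] {G G' : SimpleGraph V} {v w a b : V}

lemma sum_indicator_mul_indicator {F W : Set (Sym2 V)} (hF : F ⊆ G'.edgeSet) :
    ∑ e : G'.edgeSet, (if (e : Sym2 V) ∈ F then (1 : ℝ) else 0) *
      (if (e : Sym2 V) ∈ W then 1 else 0) = (F ∩ W).ncard := by
  have himage : F ∩ W = Subtype.val '' {e : G'.edgeSet | (e : Sym2 V) ∈ F ∩ W} := by
    ext e
    simp only [Set.mem_image, Set.mem_ofPred_eq, Subtype.exists, exists_and_left, exists_prop,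
      exists_eq_right_right]
    exact ⟨fun he => ⟨he, hF he.1⟩, fun he => he.1⟩
  rw [himage, Set.ncard_image_of_injective _ Subtype.val_injective, Set.ncard_eq_toFinset_card']
  simp only [← ite_and, mul_ite, mul_one, mul_zero, Finset.sum_boole]
  congr 2
  ext e
  simp [and_comm]

namespace IsBridgeCut

variable (h : IsBridgeCut G v w a b)
include h

/-- A facet satisfies no further equation of the form
`∑_{f ∈ F} (1 - x_f) = k (1 - x_g)`. -/
lemma false_of_relation (hGG' : G ≤ G') (hvw' : G'.Adj v w) (hG : G.Connected)
    (hvw : ¬ G.Adj v w)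
    (hfacet : IsFacet (polytope G G') (cutFace G G' ⟨s(v, w), hvw'⟩ {s(a, b)}))
    {F : Set (Sym2 V)} (hne : F.Nonempty) (hF : F ⊆ crossing G G' v w {s(a, b)})
    {g : G'.edgeSet} (hg : (g : Sym2 V) ∉ F) (k : ℝ)
    (hrel : ∀ x ∈ cutFaceVertices G G' ⟨s(v, w), hvw'⟩ {s(a, b)},
      ∑ e : G'.edgeSet, (if (e : Sym2 V) ∈ F then (1 : ℝ) else 0) * (1 - x e) = k * (1 - x g)) :
    False := by
  obtain ⟨f, hf⟩ := hne
  have hfc := hF hf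
  have h0 := (h.isFacet_iff hGG' hvw' hG hvw).1 hfacet
    (fun e => (if (e : Sym2 V) ∈ F then (1 : ℝ) else 0) - k * (if e = g then 1 else 0))
    (∑ e : G'.edgeSet, (if (e : Sym2 V) ∈ F then (1 : ℝ) else 0) - k) (fun x hx => by
      have h1 := hrel x hx
      have h2 : ∑ e : G'.edgeSet, k * (if e = g then 1 else 0) * x e = k * x g := by
        simp
      simp_rw [sub_mul, Finset.sum_sub_distrib, h2]
      simp_rw [mul_sub, mul_one, Finset.sum_sub_distrib] at h1
      linarith)
    ⟨f, hfc.1⟩ (fun he => hfc.2.1 (by rw [show f = s(a, b) from he]; exact h.adj)) hfc.2.2.1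
  have hfg : (⟨f, hfc.1⟩ : G'.edgeSet) ≠ g := fun he => hg (he ▸ hf)
  simp [hf, hfg] at h0

lemma cutCondition2_of_isFacet (hGG' : G ≤ G') (hvw' : G'.Adj v w) (hG : G.Connected)
    (hvw : ¬ G.Adj v w)
    (hfacet : IsFacet (polytope G G') (cutFace G G' ⟨s(v, w), hvw'⟩ {s(a, b)})) :
    CutCondition2 G G' v w {s(a, b)} := by
  intro F hne hF
  by_contra! hcon
  refine h.false_of_relation hGG' hvw' hG hvw hfacet hne hF (g := ⟨s(a, b), hGG' h.adj⟩)
    (fun hg => (hF hg).2.1 h.adj) ((F ∩ crossingIn G G' v w {s(a, b)} Set.univ).ncard : ℝ)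
    fun x hx => ?_
  obtain ⟨U, hU, hbar, hx⟩ := h.exists_cutConnected_of_mem_face hGG' hvw' hG hvw hx
  have hsum : ∑ e : G'.edgeSet, (if (e : Sym2 V) ∈ F then (1 : ℝ) else 0) * (1 - x e) =
      (F ∩ crossingIn G G' v w {s(a, b)} U).ncard := by
    rw [← sum_indicator_mul_indicator (G' := G') (fun e he => (hF he).1)]
    refine Finset.sum_congr rfl fun e _ => ?_
    split_ifs with h1 h2 h2
    · rw [hx e (hF h1), if_pos h2]
    · rw [hx e (hF h1), if_neg h2]
    all_goals simp
  rw [hsum, hbar]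
  split_ifs with he
  · rw [mul_one, hcon s(a, b) rfl U Set.univ hU (Or.inl (h.properlyConnected_univ hG)) he
      ⟨h.adj, fun _ _ => trivial⟩]
  · have hI := hU.resolve_left fun hP => he ⟨h.adj, fun u hu => by
      rcases Sym2.mem_iff.1 hu with rfl | rfl
      exacts [h.left_mem_core _ hP, h.right_mem_core _ hP]⟩
    rw [crossingIn_eq_empty_of_improperlyConnected hI]
    simp

lemma cutCondition3_of_isFacet (hGG' : G ≤ G') (hvw' : G'.Adj v w) (hG : G.Connected)
    (hvw : ¬ G.Adj v w)
    (hfacet : IsFacet (polytope G G') (cutFace G G' ⟨s(v, w), hvw'⟩ {s(a, b)})) :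
    CutCondition3 G G' v w {s(a, b)} := by
  intro f' hf' F hne hF k
  by_contra! hcon
  refine h.false_of_relation hGG' hvw' hG hvw hfacet hne (fun f hf => (hF hf).1)
    (g := ⟨f', hf'.1⟩) (fun hg => (hF hg).2 rfl) k fun x hx => ?_
  obtain ⟨U, hU, -, hx⟩ := h.exists_cutConnected_of_mem_face hGG' hvw' hG hvw hx
  have hsum : ∑ e : G'.edgeSet, (if (e : Sym2 V) ∈ F then (1 : ℝ) else 0) * (1 - x e) =
      (F ∩ crossingIn G G' v w {s(a, b)} U).ncard := by
    rw [← sum_indicator_mul_indicator (G' := G') (fun e he => (hF he).1.1)]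
    refine Finset.sum_congr rfl fun e _ => ?_
    split_ifs with h1 h2 h2
    · rw [hx e (hF h1).1, if_pos h2]
    · rw [hx e (hF h1).1, if_neg h2]
    all_goals simp
  rw [hsum, hx ⟨f', hf'.1⟩ hf']
  have hI : ImproperlyConnected G v w {s(a, b)} {a} :=
    ⟨⟨induce_singleton_preconnected a⟩, Or.inl (Set.singleton_subset_iff.2 h.left)⟩
  split_ifs with he
  · rw [(hcon U {a} hU (Or.inr hI) he (by
      rw [crossingIn_eq_empty_of_improperlyConnected hI]; exact Set.notMem_empty _)).1, mul_one]
  · rw [(hcon Set.univ U (Or.inl (h.properlyConnected_univ hG)) hU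
      ⟨hf', fun _ _ => trivial⟩ he).2, mul_zero, Nat.cast_zero]

end IsBridgeCut

/-! ### General position implies that the face is a facet -/

lemma coeff_eq_zero_of_mem_side {C : Set (Sym2 V)} {α : G'.edgeSet → ℝ} {β : ℝ} {z p q : V}
    (hα : ∀ U : Set V, (G.induce U).Preconnected → U ⊆ side G C z →
      ∑ e, α e * cutVector G' U e = β)
    (hpq : G'.Adj p q) (hp : p ∈ side G C z) (hq : q ∈ side G C z) :
    α ⟨s(p, q), hpq⟩ = 0 := by
  obtain ⟨D, hpD, hqD, hD, h₀, h₁, h₂, h₃⟩ :=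
    exists_interior hpq.ne (SimpleGraph.Reachable.trans (SimpleGraph.Reachable.symm hp) hq)
  have hD' : D ⊆ side G C z := fun x hx => SimpleGraph.Reachable.trans hp (hD x hx)
  have hmono : ∀ U : Set V, ((G.deleteEdges C).induce U).Preconnected →
      (G.induce U).Preconnected :=
    fun U hU => hU.mono fun _ _ hxy => SimpleGraph.deleteEdges_le C hxy
  exact coeff_eq_zero_of_insert hpD hqD hpq (hα _ (hmono _ h₀) hD')
    (hα _ (hmono _ h₁) (Set.insert_subset hp hD')) (hα _ (hmono _ h₂) (Set.insert_subset hq hD'))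
    (hα _ (hmono _ h₃) (Set.insert_subset hp (Set.insert_subset hq hD')))

namespace IsBridgeCut

variable (h : IsBridgeCut G v w a b)
include h

lemma coeff_eq_zero_of_not_mem_core {α : G'.edgeSet → ℝ} {β : ℝ} {p q : V}
    (hα : ∀ U : Set V, (G.induce U).Preconnected → v ∈ U → w ∈ U →
      ∑ e, α e * cutVector G' U e = β)
    (hpq : G'.Adj p q) (hpv : p ∈ side G {s(a, b)} v) (hqw : q ∈ side G {s(a, b)} w)
    (hp : p ∉ core G v w {s(a, b)}) (hq : q ∉ core G v w {s(a, b)}) :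
    α ⟨s(p, q), hpq⟩ = 0 := by
  obtain ⟨U₁, hU₁, hp₁⟩ := exists_avoiding_of_not_mem_core hp
  obtain ⟨U₂, hU₂, hq₂⟩ := exists_avoiding_of_not_mem_core hq
  obtain ⟨U, hU, hpU, hqU⟩ := h.exists_properlyConnected_avoiding hU₁ hU₂ hpv hqw hp₁ hq₂
  obtain ⟨D, hUD, hD, hav, hmax⟩ := exists_maximal_avoiding (Z := {p, q}) hU.1 (by
    rintro z (rfl | rfl) <;> assumption)
  have hvD := hUD hU.2.1
  have hwD := hUD hU.2.2.1
  -- A walk within one side can leave `D` only into the node of that side that `D` avoids.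
  have key : ∀ {x y : V}, x ∈ D → y ∈ ({p, q} : Set V) → y ∈ side G {s(a, b)} x →
      (∀ z ∈ ({p, q} : Set V), z ∈ side G {s(a, b)} x → z = y) → ∃ u ∈ D, G.Adj u y := by
    intro x y hx hy hxy huniq
    obtain ⟨P⟩ := hxy
    obtain ⟨d, hd, h1, h2⟩ := P.exists_boundary_dart D hx (hav y hy)
    have hadj : G.Adj d.fst d.snd := SimpleGraph.deleteEdges_le _ d.adj
    refine ⟨d.fst, h1, ?_⟩
    rw [← huniq d.snd (hmax _ h1 _ hadj h2)
      ⟨P.takeUntil _ (P.dart_snd_mem_support_of_mem_darts hd)⟩]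
    exact hadj
  obtain ⟨x, hx, hxp⟩ := key hvD (Or.inl rfl) hpv (by
    rintro z (rfl | rfl) hz
    · rfl
    · exact absurd hqw (h.disjoint _ hz))
  obtain ⟨y, hy, hyq⟩ := key hwD (Or.inr rfl) hqw (by
    rintro z (rfl | rfl) hz
    · exact absurd hz (h.disjoint _ hpv)
    · rfl)
  have hDq := (induce_insert_connected hD.preconnected hy hyq).preconnected
  exact coeff_eq_zero_of_insert (hav p (Or.inl rfl)) (hav q (Or.inr rfl)) hpq
    (hα _ hD.preconnected hvD hwD)
    (hα _ (induce_insert_connected hD.preconnected hx hxp).preconnected (Or.inr hvD) (Or.inr hwD))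
    (hα _ hDq (Or.inr hvD) (Or.inr hwD))
    (hα _ (induce_insert_connected hDq (Or.inr hx) hxp).preconnected
      (Or.inr (Or.inr hvD)) (Or.inr (Or.inr hwD)))

/-- Adding a node `p` outside the core to a maximal properly connected set that avoids `p` changes
the values of edges at `p` only; if all of these but `pq` have coefficient zero, then so has `pq`. -/
lemma coeff_eq_zero_of_mem_core (hG : G.Connected) {α : G'.edgeSet → ℝ} {β : ℝ} {p q : V}
    (hα : ∀ U : Set V, (G.induce U).Preconnected → v ∈ U → w ∈ U →
      ∑ e, α e * cutVector G' U e = β)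
    (hpq : G'.Adj p q) (hp : p ∉ core G v w {s(a, b)}) (hq : q ∈ core G v w {s(a, b)})
    (hzero : ∀ q' (hpq' : G'.Adj p q'), q' ≠ q → α ⟨s(p, q'), hpq'⟩ = 0) :
    α ⟨s(p, q), hpq⟩ = 0 := by
  obtain ⟨U, hU, hpU⟩ := exists_avoiding_of_not_mem_core hp
  obtain ⟨D, hUD, hD, hav, hmax⟩ := exists_maximal_avoiding (Z := {p}) hU.1 (by
    rintro z rfl; exact hpU)
  have hvD := hUD hU.2.1
  have hwD := hUD hU.2.2.1
  have hpD : p ∉ D := hav p rfl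
  have hqD : q ∈ D := hq D (h.properlyConnected_iff.2 ⟨hD, hvD, hwD⟩)
  obtain ⟨x, hx, hxp⟩ : ∃ x ∈ D, G.Adj x p := by
    obtain ⟨P⟩ := hG.preconnected v p
    obtain ⟨d, -, h1, h2⟩ := P.exists_boundary_dart D hvD hpD
    have : d.snd = p := hmax _ h1 _ d.adj h2
    exact ⟨d.fst, h1, this ▸ d.adj⟩
  have h₀ := hα D hD.preconnected hvD hwD
  have h₁ := hα _ (induce_insert_connected hD.preconnected hx hxp).preconnected
    (Or.inr hvD) (Or.inr hwD)
  have hdiff : ∑ e, α e * (cutVector G' D e - cutVector G' (insert p D) e) = 0 := by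
    simp_rw [mul_sub, Finset.sum_sub_distrib, h₀, h₁, sub_self]
  rw [Finset.sum_eq_single ⟨s(p, q), hpq⟩] at hdiff
  · rw [cutVector_of_not_subset (u := p) (Sym2.mem_mk_left _ _) hpD,
      cutVector_of_subset (by simp [hqD])] at hdiff
    linarith
  · rintro ⟨e, he⟩ - hne
    by_cases hpe : p ∈ e
    · obtain ⟨q', rfl⟩ := Sym2.mem_iff_exists.1 hpe
      rw [hzero q' he (fun hq' => hne (by subst hq'; rfl)), zero_mul]
    · have : (∀ u ∈ e, u ∈ insert p D) ↔ ∀ u ∈ e, u ∈ D :=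
        forall₂_congr fun u hu => by
          rw [Set.mem_insert_iff, or_iff_right]
          rintro rfl
          exact hpe hu
      have hcv : cutVector G' (insert p D) ⟨e, he⟩ = cutVector G' D ⟨e, he⟩ :=
        cutVector_congr this
      rw [hcv, sub_self, mul_zero]
  · simp

lemma isFacet_of_isThin (hGG' : G ≤ G') (hvw' : G'.Adj v w) (hG : G.Connected)
    (hvw : ¬ G.Adj v w) (ht : IsThin G G' v w {s(a, b)}) :
    IsFacet (polytope G G') (cutFace G G' ⟨s(v, w), hvw'⟩ {s(a, b)}) := by
  rw [h.isFacet_iff hGG' hvw' hG hvw]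
  intro α β hα
  have hprop : ∀ U : Set V, (G.induce U).Preconnected → v ∈ U → w ∈ U →
      ∑ e, α e * cutVector G' U e = β :=
    fun U hU hv hw => hα _ (h.cutVector_mem_face hGG' hvw' hU (Or.inl ⟨hv, hw⟩))
  have hswap : ∀ {p q : V} (hpq : G'.Adj p q),
      (⟨s(p, q), hpq⟩ : G'.edgeSet) = ⟨s(q, p), hpq.symm⟩ := fun _ => Subtype.ext Sym2.eq_swap
  -- Either the coefficient is zero because both nodes lie on one side, or the edge crosses.
  have hside : ∀ p q (hpq : G'.Adj p q), α ⟨s(p, q), hpq⟩ = 0 ∨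
      (s(p, q) ≠ s(a, b) → s(p, q) ≠ s(v, w) → s(p, q) ∈ crossing G G' v w {s(a, b)}) := by
    intro p q hpq
    rcases h.cover p with hp | hp <;> rcases h.cover q with hq | hq
    · exact Or.inl (coeff_eq_zero_of_mem_side (fun U hU hUv =>
        hα _ (h.cutVector_mem_face hGG' hvw' hU (Or.inr (Or.inl hUv)))) hpq hp hq)
    · exact Or.inr (h.mem_crossing hpq hp hq)
    · refine Or.inr ?_
      rw [Sym2.eq_swap]
      exact h.mem_crossing hpq.symm hq hp
    · exact Or.inl (coeff_eq_zero_of_mem_side (fun U hU hUw =>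
        hα _ (h.cutVector_mem_face hGG' hvw' hU (Or.inr (Or.inr hUw)))) hpq hp hq)
  have hout : ∀ p q (hpq : G'.Adj p q), s(p, q) ∈ crossing G G' v w {s(a, b)} →
      p ∉ core G v w {s(a, b)} → q ∉ core G v w {s(a, b)} → α ⟨s(p, q), hpq⟩ = 0 := by
    intro p q hpq hc hp hq
    rcases h.sides_of_mem_crossing hc with ⟨hpv, hqw⟩ | ⟨hpw, hqv⟩
    · exact h.coeff_eq_zero_of_not_mem_core hprop hpq hpv hqw hp hq
    · rw [hswap hpq]
      exact h.coeff_eq_zero_of_not_mem_core hprop hpq.symm hqv hpw hq hp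
  have hmixed : ∀ p q (hpq : G'.Adj p q), s(p, q) ∈ crossing G G' v w {s(a, b)} →
      p ∉ core G v w {s(a, b)} → q ∈ core G v w {s(a, b)} → α ⟨s(p, q), hpq⟩ = 0 := by
    intro p q hpq hc hp hq
    refine h.coeff_eq_zero_of_mem_core hG hprop hpq hp hq fun q' hpq' hne => ?_
    refine (hside p q' hpq').elim id fun hc' => ?_
    have hc' := hc'
      (fun he => by
        rcases Sym2.eq_iff.1 he with ⟨rfl, -⟩ | ⟨rfl, -⟩
        exacts [hp h.left_mem_core, hp h.right_mem_core])
      (fun he => by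
        rcases Sym2.eq_iff.1 he with ⟨rfl, -⟩ | ⟨rfl, -⟩
        exacts [hp fun U hU => hU.2.1, hp fun U hU => hU.2.2.1])
    exact hout p q' hpq' hc' hp fun hq' => hne (ht.unique p q' q hc' hc hq' hq)
  rintro ⟨e, he⟩ hab hne
  induction e with
  | _ p q =>
    refine (hside p q he).elim id fun hc => ?_
    have hc := hc hab hne
    by_cases hp : p ∈ core G v w {s(a, b)}
    · rw [hswap he]
      exact hmixed q p _ (Sym2.eq_swap (a := p) ▸ hc) (ht.not_mem_core p q hc hp) hp
    · by_cases hq : q ∈ core G v w {s(a, b)}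
      · exact hmixed p q he hc hp hq
      · exact hout p q he hc hp hq

end IsBridgeCut

end Facet

end LiftedMulticut

theorem theorem6 {V : Type*} [Fintype V] (G G' : SimpleGraph V) (hG : G.Connected)
    (hGG' : G ≤ G') (v w : V) (hvw' : G'.Adj v w) (hvw : ¬ G.Adj v w)
    (C : Set (Sym2 V)) (hC : LiftedMulticut.IsCut G v w C) (ebar : Sym2 V) (hCe : C = {ebar}) :
    LiftedMulticut.IsFacet (LiftedMulticut.polytope G G')
        (LiftedMulticut.cutFace G G' ⟨s(v, w), hvw'⟩ C) ↔
      LiftedMulticut.CutCondition1 G v w C ∧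
      LiftedMulticut.CutCondition2 G G' v w C ∧
      LiftedMulticut.CutCondition3 G G' v w C ∧
      LiftedMulticut.CutCondition4 G G' v w C ∧
      LiftedMulticut.CutCondition5 G G' v w C := by
  subst hCe
  obtain ⟨a, b, rfl, h⟩ := hC.exists_isBridgeCut hG
  constructor
  · intro hfacet
    have h2 := h.cutCondition2_of_isFacet hGG' hvw' hG hvw hfacet
    have h3 := h.cutCondition3_of_isFacet hGG' hvw' hG hvw hfacet
    have ht := h.isThin_of_conditions h2 h3
    exact ⟨h.cutCondition1 hG, h2, h3, ht.cutCondition4 h, ht.cutCondition5 h⟩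
  · rintro ⟨-, h2, h3, -, -⟩
    exact h.isFacet_of_isThin hGG' hvw' hG hvw (h.isThin_of_conditions h2 h3)
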